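/- **Setting.** Let $\Theta\subseteq\mathbb R$, $\kappa:\Theta\to\mathbb R$, $v>0$, $\varphi>0$. A real random variable $Y$ is $\mathrm{EDF}(\theta,v,\varphi,\kappa)$-distributed, $\theta\in\Theta$, if there are a $\sigma$-finite measure $\nu$ on $\mathbb R$ and a measurable function $a:\mathbb R\to\mathbb R$, both not depending on the canonical parameter, such that $\exp\{(y\theta'-\kappa(\theta'))/(\varphi/v)+a(y)\}$ integrates to one with respect to $\nu$ for every $\theta'\in\Theta$, $\Theta$ is the set of all $\theta'$ for which $\int \exp\{y\theta'/(\varphi/v)+a(y)\}\,\nu(dy)<\infty$ (the effective domain), and $Y$ has this density at $\theta'=\theta$ with respect to $\nu$. Let $M=\kappa'(\mathring\Theta)$ be the mean parameter space and $h=(\kappa')^{-1}:M\to\mathring\Theta$ the canonical link. For $\mu\in M$ let $F(y;h(\mu),v,\varphi,\kappa)=\mathbb P(Y\le y)$ and $F^*(y;h(\mu),v,\varphi,\kappa)=\mathbb P(Y<y)$ for $Y\sim\mathrm{EDF}(h(\mu),v,\varphi,\kappa)$, and set $$l^\delta(y,v,\varphi,\kappa)=\inf\{\mu\in M: F^*(y;h(\mu),v,\varphi,\kappa)\le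 1-\delta\},\qquad u^\delta(y,v,\varphi,\kappa)=\sup\{\mu\in M: F(y;h(\mu),v,\varphi,\kappa)\ge\delta\}.$$ Infima and suprema are taken in $[-\infty,\infty]$, and throughout $\inf\emptyset=\sup M$ and $\sup\emptyset=\inf M$. Let $n\ge 0$, $v_1,\dots,v_n>0$, $\varphi>0$, $\alpha\in(0,1)$, let $\mathcal J\subseteq\{1,\dots,n\}^2$ be a set of pairs $(j,k)$ with $j\le k$, and $\delta=\alpha/(2|\mathcal J|)$. For responses $Y_1,\dots,Y_n$ put $v_{j:k}=\sum_{i=j}^k v_i$ and $Z_{j:k}=v_{j:k}^{-1}\sum_{i=j}^k v_iY_i$, and, for canonical parameters $\theta_1,\dots,\theta_n$, $$L^\alpha_{\boldsymbol Y,i}=\sup_{(j,k)\in\mathcal J:\,\theta_i\ge\theta_k} l^\delta(Z_{j:k},v_{j:k},\varphi,\kappa),\qquad U^\alpha_{\boldsymbol Y,i}=\inf_{(j,k)\in\mathcal J:\,\theta_i\le\theta_j} u^\delta(Z_{j:k},v_{j:k},\varphi,\kappa).$$ **Coverage.** Let $N_1,\dots,N_n$ be independent and such that $Y_i=\varphi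 N_i/v_i\sim\mathrm{EDF}(\theta_i,v_i,\varphi,\kappa)$, where $\mathring\Theta\ne\emptyset$, $\theta_i\in\mathring\Theta$ for all $i$, and the underlying $\sigma$-finite measures $\nu_i$ are not a single point mass. Let $\mu_i=\mathbb E[Y_i]$ and assume $\mu_1\le\dots\le\mu_n$. Then $L^\alpha_{\boldsymbol Y,i}$ and $U^\alpha_{\boldsymbol Y,i}$ are (up to null sets) measurable, and $$\mathbb P\bigl(L^\alpha_{\boldsymbol Y,i}\le\mu_i\le U^\alpha_{\boldsymbol Y,i}\text{ for all }i\in\{1,\dots,n\}\bigr)\ge 1-\alpha .$$ **Explicit bounds.** Let $q_B(\cdot;a,b)$ be the quantile function of the beta distribution with parameters $a,b>0$ and $q_\Gamma(\cdot;\gamma,c)$ that of the gamma distribution with shape $\gamma>0$ and scale $c>0$ (a product with a vanishing indicator is zero). Let $N_1,\dots,N_n$ be independent with parameters $\mu_1\le\dots\le\mu_n$ in one of the three cases below, and $Y_i=\varphi N_i/v_i$. Then, with the stated $\Theta$, $\kappa$ and $\theta_i$, the $N_i$ satisfy all the assumptions of the coverage statement, $\mathbb E[Y_i]=\mu_i$,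 the coverage inequality holds, and almost surely, for all $i$, the bounds are as follows. * *Binomial case.* $N_i\sim\mathrm{Bin}(v_i/\varphi,\mu_i)$ with $v_i/\varphi\in\mathbb N$, $\mu_i\in(0,1)$; $\Theta=\mathbb R$, $\kappa(\theta)=\log(1+e^\theta)$, $\theta_i=\log(\mu_i/(1-\mu_i))$, $M=(0,1)$: $$L^\alpha_{\boldsymbol Y,i}=\sup_{(j,k)\in\mathcal J:\,\mu_i\ge\mu_k} q_B\Bigl(\delta;\tfrac{v_{j:k}Z_{j:k}}{\varphi},1+\tfrac{v_{j:k}}{\varphi}-\tfrac{v_{j:k}Z_{j:k}}{\varphi}\Bigr)\mathbf 1_{\{Z_{j:k}>0\}},$$ $$U^\alpha_{\boldsymbol Y,i}=\inf_{(j,k)\in\mathcal J:\,\mu_i\le\mu_j}\Bigl[ q_B\Bigl(1-\delta;1+\tfrac{v_{j:k}Z_{j:k}}{\varphi},\tfrac{v_{j:k}}{\varphi}-\tfrac{v_{j:k}Z_{j:k}}{\varphi}\Bigr)\mathbf 1_{\{Z_{j:k}<1\}}+\mathbf 1_{\{Z_{j:k}=1\}}\Bigr].$$ * *Poisson case.*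 $N_i\sim\mathrm{Poi}(\mu_iv_i/\varphi)$, $\mu_i>0$; $\Theta=\mathbb R$, $\kappa=\exp$, $\theta_i=\log\mu_i$, $M=(0,\infty)$: $$L^\alpha_{\boldsymbol Y,i}=\sup_{(j,k)\in\mathcal J:\,\mu_i\ge\mu_k}\frac{\varphi\, q_\Gamma(\delta;v_{j:k}Z_{j:k}/\varphi,1)}{v_{j:k}}\mathbf 1_{\{Z_{j:k}>0\}},\qquad U^\alpha_{\boldsymbol Y,i}=\inf_{(j,k)\in\mathcal J:\,\mu_i\le\mu_j}\frac{\varphi\, q_\Gamma(1-\delta;1+v_{j:k}Z_{j:k}/\varphi,1)}{v_{j:k}}.$$ * *Negative binomial case.* $N_i\sim\mathrm{NegBin}(\mu_i,\gamma_i)$ with $\gamma_i=v_i/\varphi$, $\mu_i>0$, that is, $\mathbb P(N_i=l)=\frac{\Gamma(l+\gamma_i)}{l!\,\Gamma(\gamma_i)}p_i^l(1-p_i)^{\gamma_i}$ for $l\in\mathbb N_0$, $p_i=\mu_i/(1+\mu_i)$; $\Theta=(-\infty,0)$, $\kappa(\theta)=-\log(1-e^\theta)$, $\theta_i=\log p_i$,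 $M=(0,\infty)$: $$L^\alpha_{\boldsymbol Y,i}=\sup_{(j,k)\in\mathcal J:\,\mu_i\ge\mu_k}\frac{q_B(\delta;v_{j:k}Z_{j:k}/\varphi,v_{j:k}/\varphi)}{1-q_B(\delta;v_{j:k}Z_{j:k}/\varphi,v_{j:k}/\varphi)}\mathbf 1_{\{Z_{j:k}>0\}},$$ $$U^\alpha_{\boldsymbol Y,i}=\inf_{(j,k)\in\mathcal J:\,\mu_i\le\mu_j}\frac{q_B(1-\delta;1+v_{j:k}Z_{j:k}/\varphi,v_{j:k}/\varphi)}{1-q_B(1-\delta;1+v_{j:k}Z_{j:k}/\varphi,v_{j:k}/\varphi)}.$$ -/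

import Mathlib

open MeasureTheory ProbabilityTheory Set

namespace EDF

noncomputable section

/-- The density `exp ((y θ - κ θ) / (φ / v) + a y)` of the exponential dispersion family with
canonical parameter `θ`, volume `v`, dispersion parameter `φ`, cumulant function `κ` and
normalizing function `a`. -/
def density (κ : ℝ → ℝ) (θ v φ : ℝ) (a : ℝ → ℝ) (y : ℝ) : ℝ :=
  Real.exp ((y * θ - κ θ) / (φ / v) + a y)

/-- The σ-finite measure `ν` and the normalizing function `a`, neither of which depends on the
canonical parameter, generate the family with effective domain `Θ`, cumulant function `κ` and
volume-dispersion pair `(v, φ)`: the density integrates to one for all `θ ∈ Θ`, and `Θ` is the set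
of *all* `θ` for which `exp (y θ / (φ / v) + a y)` has a finite integral. -/
structure IsReference (Θ : Set ℝ) (κ : ℝ → ℝ) (v φ : ℝ) (ν : Measure ℝ) (a : ℝ → ℝ) : Prop where
  sigmaFinite : SigmaFinite ν
  measurable_normalizing : Measurable a
  lintegral_density : ∀ θ ∈ Θ, ∫⁻ y, ENNReal.ofReal (density κ θ v φ a y) ∂ν = 1
  effective_domain : ∀ θ ∉ Θ, ∫⁻ y, ENNReal.ofReal (Real.exp (y * θ / (φ / v) + a y)) ∂ν = ⊤

/-- The measure with density `density κ θ v φ a` with respect to `ν`. -/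
def measureOf (κ : ℝ → ℝ) (θ v φ : ℝ) (ν : Measure ℝ) (a : ℝ → ℝ) : Measure ℝ :=
  ν.withDensity fun y => ENNReal.ofReal (density κ θ v φ a y)

/-- `Q` is the distribution `EDF(θ, v, φ, κ)`. -/
def IsLaw (Θ : Set ℝ) (κ : ℝ → ℝ) (θ v φ : ℝ) (Q : Measure ℝ) : Prop :=
  θ ∈ Θ ∧ 0 < v ∧ 0 < φ ∧
    ∃ (ν : Measure ℝ) (a : ℝ → ℝ), IsReference Θ κ v φ ν a ∧ Q = measureOf κ θ v φ ν a

theorem lintegral_exp_measureOf {Θ : Set ℝ} {κ : ℝ → ℝ} {θ v φ : ℝ} {ν : Measure ℝ} {a : ℝ → ℝ}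
    (hv : 0 < v) (hφ : 0 < φ) (h : IsReference Θ κ v φ ν a) (t : ℝ) :
    (θ + t * (φ / v) ∈ Θ → ∫⁻ y, ENNReal.ofReal (Real.exp (t * y)) ∂measureOf κ θ v φ ν a =
      ENNReal.ofReal (Real.exp ((κ (θ + t * (φ / v)) - κ θ) / (φ / v)))) ∧
    (θ + t * (φ / v) ∉ Θ → ∫⁻ y, ENNReal.ofReal (Real.exp (t * y)) ∂measureOf κ θ v φ ν a = ⊤) := by
  have hc : φ / v ≠ 0 := (div_pos hφ hv).ne'
  have hm := h.measurable_normalizing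
  have hd : Measurable fun y => ENNReal.ofReal (density κ θ v φ a y) := by
    unfold density; fun_prop
  have key : ∫⁻ y, ENNReal.ofReal (Real.exp (t * y)) ∂measureOf κ θ v φ ν a =
      ∫⁻ y, ENNReal.ofReal (density κ θ v φ a y * Real.exp (t * y)) ∂ν := by
    rw [measureOf, lintegral_withDensity_eq_lintegral_mul _ hd (by fun_prop)]
    refine lintegral_congr fun y => ?_
    rw [Pi.mul_apply, ENNReal.ofReal_mul (by unfold density; positivity)]
  refine ⟨fun hθ => ?_, fun hθ => ?_⟩
  · rw [key, ← mul_one (ENNReal.ofReal _), ← h.lintegral_density _ hθ,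
      ← lintegral_const_mul _ (by unfold density; fun_prop)]
    refine lintegral_congr fun y => ?_
    rw [← ENNReal.ofReal_mul (Real.exp_pos _).le]
    congr 1
    rw [density, density, ← Real.exp_add, ← Real.exp_add]
    congr 1
    generalize φ / v = c at *
    field_simp
    ring
  · have : ∀ y, ENNReal.ofReal (density κ θ v φ a y * Real.exp (t * y)) =
        ENNReal.ofReal (Real.exp (-κ θ / (φ / v))) *
          ENNReal.ofReal (Real.exp (y * (θ + t * (φ / v)) / (φ / v) + a y)) := fun y => by
      rw [← ENNReal.ofReal_mul (Real.exp_pos _).le]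
      congr 1
      rw [density, ← Real.exp_add, ← Real.exp_add]
      congr 1
      generalize φ / v = c at *
      field_simp
      ring
    rw [key, lintegral_congr this, lintegral_const_mul _ (by fun_prop), h.effective_domain _ hθ]
    exact ENNReal.mul_top (by simp [Real.exp_pos])

/-- The distribution `EDF(θ, v, φ, κ)` is determined by its parameters. -/
theorem IsLaw.unique {Θ : Set ℝ} {κ : ℝ → ℝ} {θ v φ : ℝ} {Q Q' : Measure ℝ}
    (hθ : θ ∈ interior Θ) (h : IsLaw Θ κ θ v φ Q) (h' : IsLaw Θ κ θ v φ Q') : Q = Q' := by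
  obtain ⟨hΘ, hv, hφ, ν, a, hr, rfl⟩ := h
  obtain ⟨-, -, -, ν', a', hr', rfl⟩ := h'
  have hfin : ∀ {ν a}, IsReference Θ κ v φ ν a →
      IsProbabilityMeasure (measureOf κ θ v φ ν a) := fun hr => ⟨by
    rw [measureOf, withDensity_apply _ MeasurableSet.univ, Measure.restrict_univ,
      hr.lintegral_density _ hΘ]⟩
  have := hfin hr
  have := hfin hr'
  have hmgf : mgf id (measureOf κ θ v φ ν a) = mgf id (measureOf κ θ v φ ν' a') := by
    ext t
    simp only [mgf, id]
    rw [integral_eq_lintegral_of_nonneg_ae (ae_of_all _ fun y => (Real.exp_pos _).le)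
        (by fun_prop),
      integral_eq_lintegral_of_nonneg_ae (ae_of_all _ fun y => (Real.exp_pos _).le)
        (by fun_prop)]
    have h1 := lintegral_exp_measureOf (θ := θ) hv hφ hr t
    have h2 := lintegral_exp_measureOf (θ := θ) hv hφ hr' t
    by_cases ht : θ + t * (φ / v) ∈ Θ
    · rw [h1.1 ht, h2.1 ht]
    · rw [h1.2 ht, h2.2 ht]
  have h0 : (0 : ℝ) ∈ interior (integrableExpSet id (measureOf κ θ v φ ν a)) := by
    rw [mem_interior_iff_mem_nhds]
    have hcont : Filter.Tendsto (fun t : ℝ => θ + t * (φ / v)) (nhds 0) (nhds θ) := by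
      have : Continuous fun t : ℝ => θ + t * (φ / v) := by fun_prop
      simpa using this.tendsto 0
    filter_upwards [hcont (mem_interior_iff_mem_nhds.1 hθ)] with t ht
    refine ⟨by fun_prop, ?_⟩
    rw [hasFiniteIntegral_iff_ofReal (ae_of_all _ fun y => (Real.exp_pos _).le)]
    simp only [id]
    rw [(lintegral_exp_measureOf (θ := θ) hv hφ hr t).1 ht]
    exact ENNReal.ofReal_lt_top
  refine Measure.ext_of_charFun ?_
  ext s
  rw [← complexMGF_id_mul_I, ← complexMGF_id_mul_I]
  exact eqOn_complexMGF_of_mgf hmgf (by simpa using h0)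

open scoped Classical in
/-- The distribution `EDF(θ, v, φ, κ)`. For `θ` in the interior of `Θ` there is at most one, see
`IsLaw.unique`; the value is `0` if there is none. -/
def law (Θ : Set ℝ) (κ : ℝ → ℝ) (θ v φ : ℝ) : Measure ℝ :=
  if h : ∃ Q, IsLaw Θ κ θ v φ Q then h.choose else 0

/-- The mean parameter space `κ'(interior Θ)`. -/
def meanSpace (Θ : Set ℝ) (κ : ℝ → ℝ) : Set ℝ := deriv κ '' interior Θ

/-- The canonical link `(κ')⁻¹` from the mean parameter space to `interior Θ`. -/
def link (Θ : Set ℝ) (κ : ℝ → ℝ) : ℝ → ℝ := Function.invFunOn (deriv κ) (interior Θ)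

open scoped Classical in
/-- The infimum of a set of bounds on a mean that lies in `M`; the infimum of the empty set is the
supremum of `M`. -/
def infIn (M : Set ℝ) (S : Set EReal) : EReal :=
  if S.Nonempty then sInf S else sSup (Real.toEReal '' M)

open scoped Classical in
/-- The supremum of a set of bounds on a mean that lies in `M`; the supremum of the empty set is
the infimum of `M`. -/
def supIn (M : Set ℝ) (S : Set EReal) : EReal :=
  if S.Nonempty then sSup S else sInf (Real.toEReal '' M)

/-- `l^δ(y, v, φ, κ)`: the infimum of the means `μ` with `P(Y < y) ≤ 1 - δ` for
`Y ∼ EDF(h(μ), v, φ, κ)`. -/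
def lower (Θ : Set ℝ) (κ : ℝ → ℝ) (δ v φ y : ℝ) : EReal :=
  infIn (meanSpace Θ κ) (Real.toEReal ''
    {μ | μ ∈ meanSpace Θ κ ∧ (law Θ κ (link Θ κ μ) v φ).real (Iio y) ≤ 1 - δ})

/-- `u^δ(y, v, φ, κ)`: the supremum of the means `μ` with `P(Y ≤ y) ≥ δ` for
`Y ∼ EDF(h(μ), v, φ, κ)`. -/
def upper (Θ : Set ℝ) (κ : ℝ → ℝ) (δ v φ y : ℝ) : EReal :=
  supIn (meanSpace Θ κ) (Real.toEReal ''
    {μ | μ ∈ meanSpace Θ κ ∧ δ ≤ (law Θ κ (link Θ κ μ) v φ).real (Iic y)})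

/-- The aggregated volume `v_{j:k}`. -/
def aggVol {n : ℕ} (v : Fin n → ℝ) (j k : Fin n) : ℝ := ∑ i ∈ Finset.Icc j k, v i

/-- The weighted partial sum `Z_{j:k}` of the responses `y`. -/
def aggMean {n : ℕ} (v y : Fin n → ℝ) (j k : Fin n) : ℝ :=
  1 / aggVol v j k * ∑ i ∈ Finset.Icc j k, v i * y i

/-- The level `δ = α / (2 |J|)` used for a single pair. -/
def level {n : ℕ} (J : Finset (Fin n × Fin n)) (α : ℝ) : ℝ := α / (2 * (J.card : ℝ))

/-- The lower bound `L_{y,i}^α` of the calibration band. -/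
def bandLower (Θ : Set ℝ) (κ : ℝ → ℝ) {n : ℕ} (θ v : Fin n → ℝ) (φ : ℝ)
    (J : Finset (Fin n × Fin n)) (α : ℝ) (y : Fin n → ℝ) (i : Fin n) : EReal :=
  supIn (meanSpace Θ κ) {x | ∃ p ∈ J, θ p.2 ≤ θ i ∧
    x = lower Θ κ (level J α) (aggVol v p.1 p.2) φ (aggMean v y p.1 p.2)}

/-- The upper bound `U_{y,i}^α` of the calibration band. -/
def bandUpper (Θ : Set ℝ) (κ : ℝ → ℝ) {n : ℕ} (θ v : Fin n → ℝ) (φ : ℝ)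
    (J : Finset (Fin n × Fin n)) (α : ℝ) (y : Fin n → ℝ) (i : Fin n) : EReal :=
  infIn (meanSpace Θ κ) {x | ∃ p ∈ J, θ i ≤ θ p.1 ∧
    x = upper Θ κ (level J α) (aggVol v p.1 p.2) φ (aggMean v y p.1 p.2)}

/-- The responses `Y_i = φ N_i / v_i` in reproductive form of the variables `N_i` in additive
form. -/
def response {n : ℕ} (v : Fin n → ℝ) (φ : ℝ) (N : Fin n → ℝ) (i : Fin n) : ℝ := φ * N i / v i

/-- `N_1, …, N_n` are independent members of the exponential dispersion family in additive form,
`φ N_i / v_i ∼ EDF(θ_i, v_i, φ, κ)`. The effective domain has non-empty interior, which contains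
the canonical parameters, and the reference measures are not single point masses. -/
structure IsAdditiveSample {Ω : Type*} [MeasurableSpace Ω] (P : Measure Ω) (Θ : Set ℝ) (κ : ℝ → ℝ)
    {n : ℕ} (θ v : Fin n → ℝ) (φ : ℝ) (N : Fin n → Ω → ℝ) : Prop where
  interior_nonempty : (interior Θ).Nonempty
  mem_interior : ∀ i, θ i ∈ interior Θ
  indep : iIndepFun N P
  hasLaw : ∀ i, ∃ (ν : Measure ℝ) (a : ℝ → ℝ), IsReference Θ κ (v i) φ ν a ∧
    (∀ c : ℝ, ν {c}ᶜ ≠ 0) ∧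
    HasLaw (fun ω => response v φ (fun l => N l ω) i) (measureOf κ (θ i) (v i) φ ν a) P

/-- The `q`-quantile of a distribution on the real line. -/
def quantile (Q : Measure ℝ) (q : ℝ) : ℝ := sInf {x : ℝ | q ≤ Q.real (Iic x)}

/-- `q_B(q; a, b)`, the quantile of the beta distribution. -/
def betaQuantile (q a b : ℝ) : ℝ := quantile (betaMeasure a b) q

/-- `q_Γ(q; γ, c)`, the quantile of the gamma distribution with shape `γ` and scale `c`, that is
with rate `1 / c`. -/
def gammaQuantile (q γ c : ℝ) : ℝ := quantile (gammaMeasure γ (1 / c)) q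

/-- The negative binomial distribution with mean parameter `μ > 0` and shape parameter `γ > 0`:
`l` has probability `Γ(l + γ) / (l! Γ(γ)) p ^ l (1 - p) ^ γ` for `p = μ / (1 + μ)`. -/
def negBinomial (μ γ : ℝ) : Measure ℕ :=
  Measure.sum fun l : ℕ => ENNReal.ofReal
    (Real.Gamma (l + γ) / (l.factorial * Real.Gamma γ)
      * (μ / (1 + μ)) ^ l * (1 - μ / (1 + μ)) ^ γ) • Measure.dirac l

/-- Cumulant function of the binomial case, on the effective domain `ℝ`. -/
def cumulantBin (θ : ℝ) : ℝ := Real.log (1 + Real.exp θ)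

/-- Cumulant function of the negative binomial case, on the effective domain `(-∞, 0)`. -/
def cumulantNegBin (θ : ℝ) : ℝ := -Real.log (1 - Real.exp θ)

/-- The closed form of the lower bound for one pair, binomial case; `V` and `Z` are the aggregated
volume and the weighted partial sum. -/
def lowerBin (δ V φ Z : ℝ) : ℝ :=
  betaQuantile δ (V * Z / φ) (1 + V / φ - V * Z / φ) * {z : ℝ | 0 < z}.indicator 1 Z

/-- The closed form of the upper bound for one pair, binomial case. -/
def upperBin (δ V φ Z : ℝ) : ℝ :=
  betaQuantile (1 - δ) (1 + V * Z / φ) (V / φ - V * Z / φ) * {z : ℝ | z < 1}.indicator 1 Z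
    + {z : ℝ | z = 1}.indicator 1 Z

/-- The closed form of the lower bound for one pair, Poisson case. -/
def lowerPois (δ V φ Z : ℝ) : ℝ :=
  φ * gammaQuantile δ (V * Z / φ) 1 / V * {z : ℝ | 0 < z}.indicator 1 Z

/-- The closed form of the upper bound for one pair, Poisson case. -/
def upperPois (δ V φ Z : ℝ) : ℝ := φ * gammaQuantile (1 - δ) (1 + V * Z / φ) 1 / V

/-- The closed form of the lower bound for one pair, negative binomial case. -/
def lowerNegBin (δ V φ Z : ℝ) : ℝ :=
  betaQuantile δ (V * Z / φ) (V / φ) / (1 - betaQuantile δ (V * Z / φ) (V / φ))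
    * {z : ℝ | 0 < z}.indicator 1 Z

/-- The closed form of the upper bound for one pair, negative binomial case. -/
def upperNegBin (δ V φ Z : ℝ) : ℝ :=
  betaQuantile (1 - δ) (1 + V * Z / φ) (V / φ)
    / (1 - betaQuantile (1 - δ) (1 + V * Z / φ) (V / φ))

/-- The supremum over the pairs `(j, k) ∈ J` with `μ_k ≤ μ_i` of the single-pair bounds
`l δ v_{j:k} φ Z_{j:k}`, for means in `M`. -/
def explicitLower (M : Set ℝ) (l : ℝ → ℝ → ℝ → ℝ → ℝ) {n : ℕ} (μ v : Fin n → ℝ) (φ : ℝ)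
    (J : Finset (Fin n × Fin n)) (α : ℝ) (y : Fin n → ℝ) (i : Fin n) : EReal :=
  supIn M {x | ∃ p ∈ J, μ p.2 ≤ μ i ∧
    x = ((l (level J α) (aggVol v p.1 p.2) φ (aggMean v y p.1 p.2) : ℝ) : EReal)}

/-- The infimum over the pairs `(j, k) ∈ J` with `μ_i ≤ μ_j` of the single-pair bounds
`u δ v_{j:k} φ Z_{j:k}`, for means in `M`. -/
def explicitUpper (M : Set ℝ) (u : ℝ → ℝ → ℝ → ℝ → ℝ) {n : ℕ} (μ v : Fin n → ℝ) (φ : ℝ)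
    (J : Finset (Fin n × Fin n)) (α : ℝ) (y : Fin n → ℝ) (i : Fin n) : EReal :=
  infIn M {x | ∃ p ∈ J, μ i ≤ μ p.1 ∧
    x = ((u (level J α) (aggVol v p.1 p.2) φ (aggMean v y p.1 p.2) : ℝ) : EReal)}

end

end EDF

/-!
For `θ < θ'` the densities of `EDF(θ, v, φ, κ)` and `EDF(θ', v, φ, κ)` with respect to a common
reference measure cross exactly once, at `(κ θ' - κ θ) / (θ' - θ)`. This monotone likelihood ratio
makes the family stochastically increasing in `θ`, and makes `κ'`, the mean, strictly increasing.
The exponential moments `exp ((κ (θ + t φ / v) - κ θ) v / φ)` multiply under weighted averaging, so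
the average `Z_{j:k}` of members with a common parameter is again a member, with volume `v_{j:k}`;
by coupling, for increasing parameters `Z_{j:k}` lies stochastically between `EDF(θ_j, v_{j:k})` and
`EDF(θ_k, v_{j:k})`. Since `P(Y ≤ y)` and `P(Y ≥ y)` evaluated at the observation are conservative
p-values, each of the `2 |J|` one-sided bounds fails with probability at most `α / (2 |J|)`.

The explicit bounds come from duality: as functions of the mean parameter, the partial sums of the
binomial, Poisson and negative binomial probabilities telescope upon differentiation to minus a beta
or gamma density, so they are beta or gamma tail probabilities, which the quantile functions invert.
-/

namespace EDF

/-- The exponential moments of `Q` are those of `EDF(θ, v, φ, κ)`, including that they are infinite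
off the effective domain `Θ`. Unlike `IsLaw`, this does not refer to a reference measure, which
makes it convenient to verify for concrete distributions and for sums of independent variables. -/
structure HasExpMoments (Θ : Set ℝ) (κ : ℝ → ℝ) (θ v φ : ℝ) (Q : Measure ℝ) : Prop where
  lintegral_exp : ∀ t : ℝ, θ + t * (φ / v) ∈ Θ → ∫⁻ y, ENNReal.ofReal (Real.exp (t * y)) ∂Q =
    ENNReal.ofReal (Real.exp ((κ (θ + t * (φ / v)) - κ θ) / (φ / v)))
  lintegral_exp_eq_top : ∀ t : ℝ, θ + t * (φ / v) ∉ Θ →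
    ∫⁻ y, ENNReal.ofReal (Real.exp (t * y)) ∂Q = ⊤

/-- The normalizing function for which the member with canonical parameter `θ` of the family
generated by `Q` is `Q` itself. -/
noncomputable def selfNormalizer (κ : ℝ → ℝ) (θ v φ y : ℝ) : ℝ := -((y * θ - κ θ) / (φ / v))

section Family

variable {Θ : Set ℝ} {κ : ℝ → ℝ} {θ θ' v φ : ℝ} {ν Q : Measure ℝ} {a : ℝ → ℝ}

theorem lintegral_ofReal_exp_const_add (Q : Measure ℝ) (b t : ℝ) :
    ∫⁻ y, ENNReal.ofReal (Real.exp (b + t * y)) ∂Q =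
      ENNReal.ofReal (Real.exp b) * ∫⁻ y, ENNReal.ofReal (Real.exp (t * y)) ∂Q := by
  simp only [Real.exp_add, ENNReal.ofReal_mul (Real.exp_pos b).le]
  exact lintegral_const_mul _ (by fun_prop)

theorem measurable_density (κ : ℝ → ℝ) (θ v φ : ℝ) (ha : Measurable a) :
    Measurable (density κ θ v φ a) := by
  unfold density; fun_prop

theorem density_pos (κ : ℝ → ℝ) (θ v φ : ℝ) (a : ℝ → ℝ) (y : ℝ) : 0 < density κ θ v φ a y :=
  Real.exp_pos _

theorem measureOf_selfNormalizer (κ : ℝ → ℝ) (θ v φ : ℝ) (Q : Measure ℝ) :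
    measureOf κ θ v φ Q (selfNormalizer κ θ v φ) = Q := by
  simp [measureOf, density, selfNormalizer]

theorem IsReference.isProbabilityMeasure (h : IsReference Θ κ v φ ν a) (hθ : θ ∈ Θ) :
    IsProbabilityMeasure (measureOf κ θ v φ ν a) :=
  ⟨by rw [measureOf, withDensity_apply _ MeasurableSet.univ, Measure.restrict_univ,
    h.lintegral_density _ hθ]⟩

theorem IsReference.hasExpMoments (h : IsReference Θ κ v φ ν a) (hv : 0 < v) (hφ : 0 < φ) (θ : ℝ) :
    HasExpMoments Θ κ θ v φ (measureOf κ θ v φ ν a) :=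
  ⟨fun t => (lintegral_exp_measureOf hv hφ h t).1, fun t => (lintegral_exp_measureOf hv hφ h t).2⟩

theorem IsLaw.isProbabilityMeasure (h : IsLaw Θ κ θ v φ Q) : IsProbabilityMeasure Q := by
  obtain ⟨hθ, -, -, ν, a, hr, rfl⟩ := h
  exact hr.isProbabilityMeasure hθ

theorem IsLaw.law_eq (h : IsLaw Θ κ θ v φ Q) (hθ : θ ∈ interior Θ) : law Θ κ θ v φ = Q := by
  have hex : ∃ Q, IsLaw Θ κ θ v φ Q := ⟨Q, h⟩
  rw [law, dif_pos hex]
  exact IsLaw.unique hθ hex.choose_spec h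

instance isFiniteMeasure_law (Θ : Set ℝ) (κ : ℝ → ℝ) (θ v φ : ℝ) :
    IsFiniteMeasure (law Θ κ θ v φ) := by
  unfold law
  split_ifs with h
  · have := h.choose_spec.isProbabilityMeasure
    infer_instance
  · infer_instance

namespace HasExpMoments

theorem isProbabilityMeasure (hQ : HasExpMoments Θ κ θ v φ Q) (hθ : θ ∈ Θ) :
    IsProbabilityMeasure Q :=
  ⟨by simpa using hQ.lintegral_exp 0 (by simpa using hθ)⟩

theorem isReference (hQ : HasExpMoments Θ κ θ v φ Q) (hθ : θ ∈ Θ) (hv : 0 < v) (hφ : 0 < φ) :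
    IsReference Θ κ v φ Q (selfNormalizer κ θ v φ) := by
  have := hQ.isProbabilityMeasure hθ
  have hshift : ∀ θ', θ + (θ' - θ) / (φ / v) * (φ / v) = θ' := fun θ' => by
    rw [div_mul_cancel₀ _ (div_pos hφ hv).ne', add_sub_cancel]
  refine ⟨inferInstance, by unfold selfNormalizer; fun_prop, fun θ' hθ' => ?_, fun θ' hθ' => ?_⟩
  · have hdensity : ∀ y, density κ θ' v φ (selfNormalizer κ θ v φ) y =
        Real.exp (-((κ θ' - κ θ) / (φ / v)) + (θ' - θ) / (φ / v) * y) := fun y => by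
      rw [density, selfNormalizer]
      ring_nf
    simp only [hdensity]
    rw [lintegral_ofReal_exp_const_add, hQ.lintegral_exp _ (by rwa [hshift]), hshift,
      ← ENNReal.ofReal_mul (Real.exp_pos _).le, ← Real.exp_add, neg_add_cancel, Real.exp_zero,
      ENNReal.ofReal_one]
  · have hexponent : ∀ y, y * θ' / (φ / v) + selfNormalizer κ θ v φ y =
        κ θ / (φ / v) + (θ' - θ) / (φ / v) * y := fun y => by
      rw [selfNormalizer]
      ring
    simp only [hexponent]
    rw [lintegral_ofReal_exp_const_add, hQ.lintegral_exp_eq_top _ (by rwa [hshift])]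
    exact ENNReal.mul_top (ENNReal.ofReal_pos.2 (Real.exp_pos _)).ne'

theorem isLaw (hQ : HasExpMoments Θ κ θ v φ Q) (hθ : θ ∈ Θ) (hv : 0 < v) (hφ : 0 < φ) :
    IsLaw Θ κ θ v φ Q :=
  ⟨hθ, hv, hφ, Q, _, hQ.isReference hθ hv hφ, (measureOf_selfNormalizer κ θ v φ Q).symm⟩

theorem law_eq (hQ : HasExpMoments Θ κ θ v φ Q) (hθ : θ ∈ interior Θ) (hv : 0 < v) (hφ : 0 < φ) :
    law Θ κ θ v φ = Q :=
  (hQ.isLaw (interior_subset hθ) hv hφ).law_eq hθ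

theorem zero_mem_interior_integrableExpSet (hQ : HasExpMoments Θ κ θ v φ Q)
    (hθ : θ ∈ interior Θ) : (0 : ℝ) ∈ interior (integrableExpSet id Q) := by
  have hcont : ContinuousAt (fun t : ℝ => θ + t * (φ / v)) 0 := by fun_prop
  have hnhds : interior Θ ∈ nhds (θ + 0 * (φ / v)) := by
    simpa using isOpen_interior.mem_nhds hθ
  rw [mem_interior_iff_mem_nhds]
  filter_upwards [hcont hnhds] with t ht
  refine ⟨by fun_prop, ?_⟩
  rw [hasFiniteIntegral_iff_ofReal (ae_of_all _ fun y => (Real.exp_pos _).le)]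
  exact (hQ.lintegral_exp t (interior_subset ht)).trans_lt ENNReal.ofReal_lt_top

theorem integrable (hQ : HasExpMoments Θ κ θ v φ Q) (hθ : θ ∈ interior Θ) : Integrable id Q :=
  integrable_of_mem_interior_integrableExpSet (hQ.zero_mem_interior_integrableExpSet hθ)

theorem cgf_eq (hQ : HasExpMoments Θ κ θ v φ Q) {t : ℝ} (ht : θ + t * (φ / v) ∈ Θ) :
    cgf id Q t = (κ (θ + t * (φ / v)) - κ θ) / (φ / v) := by
  rw [cgf, mgf, integral_eq_lintegral_of_nonneg_ae (ae_of_all _ fun y => (Real.exp_pos _).le)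
    (by fun_prop)]
  simp only [id_eq]
  rw [hQ.lintegral_exp t ht, ENNReal.toReal_ofReal (Real.exp_pos _).le, Real.log_exp]

theorem hasDerivAt (hQ : HasExpMoments Θ κ θ v φ Q) (hθ : θ ∈ interior Θ) (hv : 0 < v)
    (hφ : 0 < φ) : HasDerivAt κ (∫ y, y ∂Q) θ := by
  have hc : φ / v ≠ 0 := (div_pos hφ hv).ne'
  have := hQ.isProbabilityMeasure (interior_subset hθ)
  have hcgf : HasDerivAt (cgf id Q) (∫ y, y ∂Q) ((θ - θ) / (φ / v)) := by
    have h0 := hQ.zero_mem_interior_integrableExpSet hθ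
    have hd := (analyticAt_cgf h0).differentiableAt.hasDerivAt
    rw [deriv_cgf_zero h0, probReal_univ, div_one] at hd
    simpa using hd
  have hrescale : HasDerivAt (fun x => (x - θ) / (φ / v)) (1 / (φ / v)) θ :=
    ((hasDerivAt_id θ).sub_const θ).div_const _
  have hκ : HasDerivAt (fun x => κ θ + φ / v * cgf id Q ((x - θ) / (φ / v))) (∫ y, y ∂Q) θ := by
    refine (((hcgf.comp θ hrescale).const_mul (φ / v)).const_add (κ θ)).congr_deriv ?_
    rw [mul_comm, mul_assoc, one_div_mul_cancel hc, mul_one]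
  refine hκ.congr_of_eventuallyEq ?_
  filter_upwards [mem_interior_iff_mem_nhds.1 hθ] with x hx
  have hshift : θ + (x - θ) / (φ / v) * (φ / v) = x := by rw [div_mul_cancel₀ _ hc, add_sub_cancel]
  rw [hQ.cgf_eq (by rwa [hshift]), hshift, mul_div_cancel₀ _ hc, add_sub_cancel]

theorem deriv_eq (hQ : HasExpMoments Θ κ θ v φ Q) (hθ : θ ∈ interior Θ) (hv : 0 < v)
    (hφ : 0 < φ) : deriv κ θ = ∫ y, y ∂Q :=
  (hQ.hasDerivAt hθ hv hφ).deriv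

end HasExpMoments

theorem density_le_density_iff (hv : 0 < v) (hφ : 0 < φ) (a : ℝ → ℝ) (y : ℝ) :
    density κ θ v φ a y ≤ density κ θ' v φ a y ↔ y * θ - κ θ ≤ y * θ' - κ θ' := by
  rw [density, density, Real.exp_le_exp, add_le_add_iff_right,
    div_le_div_iff_of_pos_right (div_pos hφ hv)]

theorem density_le_density_iff_crossing_le (hv : 0 < v) (hφ : 0 < φ) (hlt : θ < θ') (a : ℝ → ℝ)
    (y : ℝ) :
    density κ θ v φ a y ≤ density κ θ' v φ a y ↔ (κ θ' - κ θ) / (θ' - θ) ≤ y := by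
  rw [density_le_density_iff hv hφ, div_le_iff₀ (sub_pos.2 hlt)]
  constructor <;> intro h <;> linarith

theorem density_le_density_iff_le_crossing (hv : 0 < v) (hφ : 0 < φ) (hlt : θ < θ') (a : ℝ → ℝ)
    (y : ℝ) :
    density κ θ' v φ a y ≤ density κ θ v φ a y ↔ y ≤ (κ θ' - κ θ) / (θ' - θ) := by
  rw [density_le_density_iff hv hφ, le_div_iff₀ (sub_pos.2 hlt)]
  constructor <;> intro h <;> linarith

namespace IsReference

theorem integrable_density_mul_sub (h : IsReference Θ κ v φ ν a) (hv : 0 < v) (hφ : 0 < φ)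
    (hθ : θ ∈ interior Θ) (c : ℝ) : Integrable (fun y => density κ θ v φ a y * (y - c)) ν := by
  have := h.isProbabilityMeasure (interior_subset hθ)
  have hsub : Integrable (fun y => y - c) (measureOf κ θ v φ ν a) :=
    ((h.hasExpMoments hv hφ θ).integrable hθ).sub (integrable_const c)
  have hdensity := (measurable_density κ θ v φ h.measurable_normalizing).ennreal_ofReal
  simpa [ENNReal.toReal_ofReal (density_pos _ _ _ _ _ _).le] using
    (integrable_withDensity_iff_integrable_smul' hdensity
      (ae_of_all _ fun _ => ENNReal.ofReal_lt_top)).1 hsub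

theorem integral_density_mul_sub (h : IsReference Θ κ v φ ν a) (hv : 0 < v) (hφ : 0 < φ)
    (hθ : θ ∈ interior Θ) (c : ℝ) : ∫ y, density κ θ v φ a y * (y - c) ∂ν = deriv κ θ - c := by
  have := h.isProbabilityMeasure (interior_subset hθ)
  have hmoments := h.hasExpMoments hv hφ θ
  have hmean : ∫ y, y - c ∂measureOf κ θ v φ ν a = deriv κ θ - c := by
    rw [hmoments.deriv_eq hθ hv hφ]
    simpa using integral_sub (hmoments.integrable hθ) (integrable_const c)
  have hdensity := (measurable_density κ θ v φ h.measurable_normalizing).ennreal_ofReal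
  rw [← hmean, measureOf, integral_withDensity_eq_integral_toReal_smul hdensity
    (ae_of_all _ fun _ => ENNReal.ofReal_lt_top)]
  simp only [ENNReal.toReal_ofReal (density_pos _ _ _ _ _ _).le, smul_eq_mul]

/-- With the crossing point `y₀` of the two densities,
`κ' θ' - κ' θ = ∫ (density θ' y - density θ y) (y - y₀) dν(y)` has a positive integrand. -/
theorem strictMonoOn_deriv (h : IsReference Θ κ v φ ν a) (hν : ∀ c : ℝ, ν {c}ᶜ ≠ 0)
    (hv : 0 < v) (hφ : 0 < φ) : StrictMonoOn (deriv κ) (interior Θ) := by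
  intro θ hθ θ' hθ' hlt
  set y₀ := (κ θ' - κ θ) / (θ' - θ)
  have hint := h.integrable_density_mul_sub hv hφ hθ y₀
  have hint' := h.integrable_density_mul_sub hv hφ hθ' y₀
  have hsign : ∀ y ≠ y₀, 0 < density κ θ' v φ a y * (y - y₀) - density κ θ v φ a y * (y - y₀) := by
    intro y hy
    rw [← sub_mul]
    rcases lt_or_gt_of_ne hy with hy | hy
    · have hlt_density := not_le.1 fun hle =>
        hy.not_ge ((density_le_density_iff_crossing_le hv hφ hlt a y).1 hle)
      exact mul_pos_of_neg_of_neg (sub_neg.2 hlt_density) (sub_neg.2 hy)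
    · have hlt_density := not_le.1 fun hle =>
        hy.not_ge ((density_le_density_iff_le_crossing hv hφ hlt a y).1 hle)
      exact mul_pos (sub_pos.2 hlt_density) (sub_pos.2 hy)
  have hpos : 0 < ∫ y, (density κ θ' v φ a y * (y - y₀) - density κ θ v φ a y * (y - y₀)) ∂ν := by
    refine (integral_pos_iff_support_of_nonneg_ae (ae_of_all _ fun y => ?_) (hint'.sub hint)).2 ?_
    · rcases eq_or_ne y y₀ with rfl | hy
      · simp
      · exact (hsign y hy).le
    · exact (pos_iff_ne_zero.2 (hν y₀)).trans_le (measure_mono fun y hy => (hsign y hy).ne')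
  rw [integral_sub hint' hint, h.integral_density_mul_sub hv hφ hθ',
    h.integral_density_mul_sub hv hφ hθ] at hpos
  linarith

end IsReference

end Family

/-- The usual stochastic order: `μ` gives no measurable upper set more mass than `ν` does. -/
def StochLE {E : Type*} [Preorder E] [MeasurableSpace E] (μ ν : Measure E) : Prop :=
  ∀ A : Set E, IsUpperSet A → MeasurableSet A → μ A ≤ ν A

theorem prob_compl_le_prob_compl_iff {E : Type*} [MeasurableSpace E] {μ ν : Measure E}
    [IsProbabilityMeasure μ] [IsProbabilityMeasure ν] {A : Set E} (hA : MeasurableSet A) :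
    ν Aᶜ ≤ μ Aᶜ ↔ μ A ≤ ν A := by
  rw [prob_compl_eq_one_sub hA, prob_compl_eq_one_sub hA]
  exact ENNReal.sub_le_sub_iff_left prob_le_one ENNReal.one_ne_top

namespace StochLE

section Preorder

variable {E F : Type*} [Preorder E] [MeasurableSpace E] [Preorder F] [MeasurableSpace F]
  {μ ν : Measure E}

theorem refl (μ : Measure E) : StochLE μ μ := fun _ _ _ => le_rfl

theorem measure_le_of_isLowerSet [IsProbabilityMeasure μ] [IsProbabilityMeasure ν]
    (h : StochLE μ ν) {A : Set E} (hA : IsLowerSet A) (hmeas : MeasurableSet A) : ν A ≤ μ A :=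
  (prob_compl_le_prob_compl_iff hmeas).1 (h _ hA.compl hmeas.compl)

theorem map (h : StochLE μ ν) {f : E → F} (hf : Monotone f) (hmeas : Measurable f) :
    StochLE (μ.map f) (ν.map f) := fun A hA hAm => by
  rw [Measure.map_apply hmeas hAm, Measure.map_apply hmeas hAm]
  exact h _ (hA.preimage hf) (hmeas hAm)

end Preorder

section Convolution

variable {E : Type*} [AddCommMonoid E] [PartialOrder E] [IsOrderedAddMonoid E] [MeasurableSpace E]
  [MeasurableAdd₂ E] {μ μ' ν ν' : Measure E}

theorem conv_left (ρ : Measure E) [SFinite ν] [SFinite ν'] (h : StochLE ν ν') :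
    StochLE (ρ ∗ ν) (ρ ∗ ν') := by
  intro A hA hmeas
  have hconv : ∀ (σ : Measure E) [SFinite σ], (ρ ∗ σ) A = ∫⁻ x, σ ((x + ·) ⁻¹' A) ∂ρ := by
    intro σ _
    rw [← lintegral_indicator_one hmeas, Measure.lintegral_conv (measurable_one.indicator hmeas)]
    exact lintegral_congr fun x => lintegral_indicator_one (hmeas.preimage (measurable_const_add x))
  rw [hconv, hconv]
  exact lintegral_mono fun x =>
    h _ (hA.preimage fun _ _ hyz => add_le_add_right hyz x)
      (hmeas.preimage (measurable_const_add x))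

theorem conv [SFinite μ] [SFinite μ'] [SFinite ν] [SFinite ν'] (h : StochLE μ ν)
    (h' : StochLE μ' ν') : StochLE (μ ∗ μ') (ν ∗ ν') := by
  intro A hA hmeas
  refine (h'.conv_left μ A hA hmeas).trans ?_
  rw [Measure.conv_comm μ, Measure.conv_comm ν]
  exact h.conv_left ν' A hA hmeas

theorem map_sum {ι Ω Ω' : Type*} {_ : MeasurableSpace Ω} {_ : MeasurableSpace Ω'} {P : Measure Ω}
    {P' : Measure Ω'} [IsProbabilityMeasure P] [IsProbabilityMeasure P'] {X : ι → Ω → E}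
    {X' : ι → Ω' → E} (hX : iIndepFun X P) (hX' : iIndepFun X' P')
    (hm : ∀ i, AEMeasurable (X i) P) (hm' : ∀ i, AEMeasurable (X' i) P') (s : Finset ι)
    (h : ∀ i ∈ s, StochLE (P.map (X i)) (P'.map (X' i))) :
    StochLE (P.map (∑ i ∈ s, X i)) (P'.map (∑ i ∈ s, X' i)) := by
  classical
  induction s using Finset.induction_on with
  | empty => simpa [Pi.zero_def] using StochLE.refl _
  | insert i s hi ih =>
    rw [Finset.sum_insert hi, Finset.sum_insert hi, add_comm, add_comm (X' i),
      (hX.indepFun_finsetSum_of_notMem₀ hm hi).map_add_eq_map_conv_map₀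
        (Finset.aemeasurable_sum _ fun j _ => hm j) (hm i),
      (hX'.indepFun_finsetSum_of_notMem₀ hm' hi).map_add_eq_map_conv_map₀
        (Finset.aemeasurable_sum _ fun j _ => hm' j) (hm' i)]
    exact (ih fun j hj => h j (Finset.mem_insert_of_mem hj)).conv
      (h i (Finset.mem_insert_self i s))

end Convolution

section PValue

variable {μ ν : Measure ℝ} [IsProbabilityMeasure ν]

theorem measure_one_sub_lt_Iio_le (h : StochLE μ ν) (δ : ℝ) :
    μ {z | 1 - δ < ν.real (Iio z)} ≤ ENNReal.ofReal δ := by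
  have hA : IsUpperSet {z | 1 - δ < ν.real (Iio z)} := fun x y hxy hx =>
    lt_of_lt_of_le hx (measureReal_mono (Iio_subset_Iio hxy))
  have hmeas := hA.ordConnected.measurableSet
  refine (h _ hA hmeas).trans ?_
  rw [hmeas.measure_eq_iSup_isCompact]
  refine iSup₂_le fun K hK => iSup_le fun hcompact => ?_
  rcases K.eq_empty_or_nonempty with rfl | hne
  · simp
  have hmass : 1 - δ < ν.real (Iio (sInf K)) := hK (hcompact.sInf_mem hne)
  have hsub : K ⊆ (Iio (sInf K))ᶜ := fun x hx => by simpa using csInf_le hcompact.bddBelow hx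
  refine (measure_mono hsub).trans ?_
  rw [← ofReal_measureReal, probReal_compl_eq_one_sub measurableSet_Iio]
  exact ENNReal.ofReal_le_ofReal (by linarith)

theorem measure_Iic_lt_le [IsProbabilityMeasure μ] (h : StochLE ν μ) (δ : ℝ) :
    μ {z | ν.real (Iic z) < δ} ≤ ENNReal.ofReal δ := by
  have hA : IsLowerSet {z | ν.real (Iic z) < δ} := fun x y hxy hx =>
    lt_of_le_of_lt (measureReal_mono (Iic_subset_Iic.2 hxy)) hx
  have hmeas := hA.ordConnected.measurableSet
  refine (h.measure_le_of_isLowerSet hA hmeas).trans ?_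
  rw [hmeas.measure_eq_iSup_isCompact]
  refine iSup₂_le fun K hK => iSup_le fun hcompact => ?_
  rcases K.eq_empty_or_nonempty with rfl | hne
  · simp
  have hmass : ν.real (Iic (sSup K)) < δ := hK (hcompact.sSup_mem hne)
  have hsub : K ⊆ Iic (sSup K) := fun x hx => le_csSup hcompact.bddAbove hx
  refine (measure_mono hsub).trans ?_
  rw [← ofReal_measureReal]
  exact ENNReal.ofReal_le_ofReal hmass.le

end PValue

end StochLE

section Monotone

variable {Θ : Set ℝ} {κ : ℝ → ℝ} {θ θ' v φ : ℝ} {ν : Measure ℝ} {a : ℝ → ℝ}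

theorem measureOf_le_of_density_le {A : Set ℝ} (hA : MeasurableSet A)
    (h : ∀ y ∈ A, density κ θ v φ a y ≤ density κ θ' v φ a y) :
    measureOf κ θ v φ ν a A ≤ measureOf κ θ' v φ ν a A := by
  rw [measureOf, measureOf, withDensity_apply _ hA, withDensity_apply _ hA]
  exact setLIntegral_mono' hA fun y hy => ENNReal.ofReal_le_ofReal (h y hy)

/-- An upper set lies to the right of the crossing point of the two densities, or its complement
lies to the left of it. -/
theorem IsReference.stochLE (h : IsReference Θ κ v φ ν a) (hv : 0 < v) (hφ : 0 < φ) (hθ : θ ∈ Θ)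
    (hθ' : θ' ∈ Θ) (hle : θ ≤ θ') :
    StochLE (measureOf κ θ v φ ν a) (measureOf κ θ' v φ ν a) := by
  rcases hle.eq_or_lt with rfl | hlt
  · exact .refl _
  intro A hA hmeas
  have := h.isProbabilityMeasure hθ
  have := h.isProbabilityMeasure hθ'
  by_cases hright : ∀ y ∈ A, (κ θ' - κ θ) / (θ' - θ) ≤ y
  · exact measureOf_le_of_density_le hmeas fun y hy =>
      (density_le_density_iff_crossing_le hv hφ hlt a y).2 (hright y hy)
  · push Not at hright
    obtain ⟨y, hy, hcross⟩ := hright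
    refine (prob_compl_le_prob_compl_iff hmeas).1
      (measureOf_le_of_density_le hmeas.compl fun x hx => ?_)
    have hxy : x ≤ y := le_of_not_ge fun hyx => hx (hA hyx hy)
    exact (density_le_density_iff_le_crossing hv hφ hlt a x).2 (hxy.trans hcross.le)

end Monotone

section Bounds

variable {Θ : Set ℝ} {κ : ℝ → ℝ} {θ v φ : ℝ} {M : Set ℝ} {S : Set EReal}

theorem infIn_le {x : EReal} (hx : x ∈ S) : infIn M S ≤ x := by
  rw [infIn, if_pos ⟨x, hx⟩]
  exact sInf_le hx

theorem le_supIn {x : EReal} (hx : x ∈ S) : x ≤ supIn M S := by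
  rw [supIn, if_pos ⟨x, hx⟩]
  exact le_sSup hx

theorem supIn_le {μ : ℝ} (hμ : μ ∈ M) (h : ∀ x ∈ S, x ≤ μ) : supIn M S ≤ μ := by
  rw [supIn]
  split_ifs with hS
  · exact sSup_le h
  · exact sInf_le ⟨μ, hμ, rfl⟩

theorem le_infIn {μ : ℝ} (hμ : μ ∈ M) (h : ∀ x ∈ S, (μ : EReal) ≤ x) : (μ : EReal) ≤ infIn M S := by
  rw [infIn]
  split_ifs with hS
  · exact le_sInf h
  · exact le_sSup ⟨μ, hμ, rfl⟩

theorem infIn_anti {S T : Set ℝ} (hST : S ⊆ T) (hT : T ⊆ M) :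
    infIn M (Real.toEReal '' T) ≤ infIn M (Real.toEReal '' S) := by
  unfold infIn
  split_ifs with h1 h2 h2
  · exact sInf_le_sInf (image_mono hST)
  · obtain ⟨x, hx⟩ := h1
    exact (sInf_le hx).trans (le_sSup (image_mono hT hx))
  · exact absurd (h2.mono (image_mono hST)) h1
  · exact le_rfl

theorem supIn_mono {S T : Set ℝ} (hST : S ⊆ T) (hT : T ⊆ M) :
    supIn M (Real.toEReal '' S) ≤ supIn M (Real.toEReal '' T) := by
  unfold supIn
  split_ifs with h1 h2 h2
  · exact sSup_le_sSup (image_mono hST)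
  · exact absurd (h1.mono (image_mono hST)) h2
  · obtain ⟨x, hx⟩ := h2
    exact (sInf_le (image_mono hT hx)).trans (le_sSup hx)
  · exact le_rfl

theorem infIn_eq_of_isGLB {S : Set ℝ} {r : ℝ} (hS : S.Nonempty) (h : IsGLB S r) :
    infIn M (Real.toEReal '' S) = r := by
  rw [infIn, if_pos (hS.image _)]
  refine le_antisymm (le_of_not_gt fun hlt => ?_) (le_sInf ?_)
  · obtain ⟨x, hrx, hx⟩ := EReal.lt_iff_exists_real_btwn.1 hlt
    refine (EReal.coe_lt_coe_iff.1 hrx).not_ge (h.2 fun y hy => ?_)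
    exact EReal.coe_le_coe_iff.1 (hx.le.trans (sInf_le ⟨y, hy, rfl⟩))
  · rintro _ ⟨x, hx, rfl⟩
    exact EReal.coe_le_coe_iff.2 (h.1 hx)

theorem supIn_eq_of_isLUB {S : Set ℝ} {r : ℝ} (hS : S.Nonempty) (h : IsLUB S r) :
    supIn M (Real.toEReal '' S) = r := by
  rw [supIn, if_pos (hS.image _)]
  refine le_antisymm (sSup_le ?_) (le_of_not_gt fun hlt => ?_)
  · rintro _ ⟨x, hx, rfl⟩
    exact EReal.coe_le_coe_iff.2 (h.1 hx)
  · obtain ⟨x, hx, hxr⟩ := EReal.lt_iff_exists_real_btwn.1 hlt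
    refine (EReal.coe_lt_coe_iff.1 hxr).not_ge (h.2 fun y hy => ?_)
    exact EReal.coe_le_coe_iff.1 ((le_sSup (mem_image_of_mem _ hy)).trans hx.le)

theorem lower_mono (Θ : Set ℝ) (κ : ℝ → ℝ) (δ v φ : ℝ) : Monotone (lower Θ κ δ v φ) :=
  fun _ _ hy => infIn_anti
    (fun _ hμ => ⟨hμ.1, (measureReal_mono (Iio_subset_Iio hy)).trans hμ.2⟩) fun _ hμ => hμ.1

theorem upper_mono (Θ : Set ℝ) (κ : ℝ → ℝ) (δ v φ : ℝ) : Monotone (upper Θ κ δ v φ) :=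
  fun _ _ hy => supIn_mono
    (fun _ hμ => ⟨hμ.1, hμ.2.trans (measureReal_mono (Iic_subset_Iic.2 hy))⟩) fun _ hμ => hμ.1

theorem link_deriv (h : InjOn (deriv κ) (interior Θ)) (hθ : θ ∈ interior Θ) :
    link Θ κ (deriv κ θ) = θ :=
  h.leftInvOn_invFunOn hθ

variable {Ω : Type*} {_ : MeasurableSpace Ω} {P : Measure Ω} {Q : Measure ℝ} {Z : Ω → ℝ}

theorem measureReal_deriv_lt_lower_le (hκ : InjOn (deriv κ) (interior Θ)) (hθ : θ ∈ interior Θ)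
    (hQ : IsLaw Θ κ θ v φ Q) (hZ : AEMeasurable Z P) (hle : StochLE (P.map Z) Q) {δ : ℝ}
    (hδ : 0 ≤ δ) : P.real {ω | ((deriv κ θ : ℝ) : EReal) < lower Θ κ δ v φ (Z ω)} ≤ δ := by
  have := hQ.isProbabilityMeasure
  refine ENNReal.toReal_le_of_le_ofReal hδ <|
    (measure_mono fun ω (hω : (_ : EReal) < _) => ?_).trans
      ((Measure.le_map_apply hZ _).trans (hle.measure_one_sub_lt_Iio_le δ))
  by_contra hn
  refine hω.not_ge (infIn_le ⟨_, ⟨⟨θ, hθ, rfl⟩, ?_⟩, rfl⟩)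
  rw [link_deriv hκ hθ, hQ.law_eq hθ]
  exact not_lt.1 hn

theorem measureReal_upper_lt_deriv_le [IsProbabilityMeasure P] (hκ : InjOn (deriv κ) (interior Θ))
    (hθ : θ ∈ interior Θ) (hQ : IsLaw Θ κ θ v φ Q) (hZ : AEMeasurable Z P)
    (hle : StochLE Q (P.map Z)) {δ : ℝ} (hδ : 0 ≤ δ) :
    P.real {ω | upper Θ κ δ v φ (Z ω) < ((deriv κ θ : ℝ) : EReal)} ≤ δ := by
  have := hQ.isProbabilityMeasure
  have := Measure.isProbabilityMeasure_map hZ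
  refine ENNReal.toReal_le_of_le_ofReal hδ <|
    (measure_mono fun ω (hω : (_ : EReal) < _) => ?_).trans
      ((Measure.le_map_apply hZ _).trans (hle.measure_Iic_lt_le δ))
  by_contra hn
  refine hω.not_ge (le_supIn ⟨_, ⟨⟨θ, hθ, rfl⟩, ?_⟩, rfl⟩)
  rw [link_deriv hκ hθ, hQ.law_eq hθ]
  exact not_lt.1 hn

end Bounds

/-- The law of the weighted partial sum `Z_{j:k}` of independent responses `Y_i ∼ Q i`. -/
noncomputable def aggLaw {n : ℕ} (v : Fin n → ℝ) (Q : Fin n → Measure ℝ) (j k : Fin n) :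
    Measure ℝ :=
  (Measure.pi Q).map fun y => aggMean v y j k

section Aggregation

variable {n : ℕ} {v : Fin n → ℝ} {φ : ℝ} {Θ : Set ℝ} {κ : ℝ → ℝ} {j k : Fin n}

theorem aggVol_pos (hv : ∀ i, 0 < v i) (hjk : j ≤ k) : 0 < aggVol v j k :=
  Finset.sum_pos (fun i _ => hv i) ⟨j, by simp [hjk]⟩

theorem aggMean_eq_sum (v y : Fin n → ℝ) (j k : Fin n) :
    aggMean v y j k = ∑ i ∈ Finset.Icc j k, v i / aggVol v j k * y i := by
  rw [aggMean, Finset.mul_sum]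
  exact Finset.sum_congr rfl fun i _ => by ring

theorem measurable_aggMean (v : Fin n → ℝ) (j k : Fin n) :
    Measurable fun y : Fin n → ℝ => aggMean v y j k := by
  simp only [aggMean_eq_sum]
  fun_prop

section Pi

variable {Q Q' : Fin n → Measure ℝ} [∀ i, IsProbabilityMeasure (Q i)]
  [∀ i, IsProbabilityMeasure (Q' i)]

theorem iIndepFun_const_mul_eval (Q : Fin n → Measure ℝ) [∀ i, IsProbabilityMeasure (Q i)]
    (w : Fin n → ℝ) : iIndepFun (fun i (y : Fin n → ℝ) => w i * y i) (Measure.pi Q) :=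
  iIndepFun_pi (X := fun i x => w i * x) fun i => by fun_prop

theorem map_const_mul_eval (Q : Fin n → Measure ℝ) [∀ i, IsProbabilityMeasure (Q i)] (c : ℝ)
    (i : Fin n) : (Measure.pi Q).map (fun y => c * y i) = (Q i).map fun x => c * x := by
  rw [← (measurePreserving_eval Q i).map_eq, Measure.map_map (by fun_prop) (by fun_prop)]
  rfl

theorem lintegral_exp_aggLaw (v : Fin n → ℝ) (Q : Fin n → Measure ℝ)
    [∀ i, IsProbabilityMeasure (Q i)] (j k : Fin n) (t : ℝ) :
    ∫⁻ y, ENNReal.ofReal (Real.exp (t * y)) ∂aggLaw v Q j k = ∏ i ∈ Finset.Icc j k,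
      ∫⁻ y, ENNReal.ofReal (Real.exp (t * (v i / aggVol v j k) * y)) ∂Q i := by
  have hexp : ∀ y : Fin n → ℝ, ENNReal.ofReal (Real.exp (t * aggMean v y j k)) =
      ∏ i ∈ Finset.Icc j k, ENNReal.ofReal (Real.exp (t * (v i / aggVol v j k) * y i)) :=
      fun y => by
    rw [← ENNReal.ofReal_prod_of_nonneg fun i _ => (Real.exp_pos _).le, ← Real.exp_sum,
      aggMean_eq_sum, Finset.mul_sum]
    simp only [mul_assoc]
  have hindep : iIndepFun (fun i (y : Fin n → ℝ) =>
      ENNReal.ofReal (Real.exp (t * (v i / aggVol v j k) * y i))) (Measure.pi Q) :=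
    iIndepFun_pi (X := fun i x => ENNReal.ofReal (Real.exp (t * (v i / aggVol v j k) * x)))
      fun i => by fun_prop
  rw [aggLaw, lintegral_map (by fun_prop) (measurable_aggMean v j k), lintegral_congr hexp,
    lintegral_prod_eq_prod_lintegral_of_indepFun _ _ hindep fun i => by fun_prop]
  refine Finset.prod_congr rfl fun i _ => ?_
  rw [← lintegral_map (f := fun x => ENNReal.ofReal (Real.exp (t * (v i / aggVol v j k) * x)))
    (by fun_prop) (measurable_pi_apply i), (measurePreserving_eval Q i).map_eq]

/-- The shift `t φ / v_{j:k}` of the canonical parameter is the one that `t v_i / v_{j:k}` causes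
at volume `v_i`, so that all factors of the exponential moment have the same parameter. -/
theorem HasExpMoments.aggLaw {θ : ℝ} (hQ : ∀ i, HasExpMoments Θ κ θ (v i) φ (Q i))
    (hv : ∀ i, 0 < v i) (hjk : j ≤ k) :
    HasExpMoments Θ κ θ (aggVol v j k) φ (aggLaw v Q j k) := by
  set V := aggVol v j k with hV
  have hshift : ∀ t i, θ + t * (v i / V) * (φ / v i) = θ + t * (φ / V) := fun t i => by
    have := (hv i).ne'
    have : V ≠ 0 := (aggVol_pos hv hjk).ne'
    field_simp
  constructor
  · intro t ht
    have hfactor : ∀ i, ∫⁻ y, ENNReal.ofReal (Real.exp (t * (v i / V) * y)) ∂Q i =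
        ENNReal.ofReal (Real.exp ((κ (θ + t * (φ / V)) - κ θ) / (φ / v i))) := fun i => by
      rw [(hQ i).lintegral_exp _ (by rwa [hshift]), hshift]
    rw [lintegral_exp_aggLaw, Finset.prod_congr rfl fun i _ => hfactor i,
      ← ENNReal.ofReal_prod_of_nonneg fun i _ => (Real.exp_pos _).le, ← Real.exp_sum]
    simp only [div_div_eq_mul_div, ← Finset.sum_div, ← Finset.mul_sum, hV, aggVol]
  · intro t ht
    have hfactor : ∀ i, ∫⁻ y, ENNReal.ofReal (Real.exp (t * (v i / V) * y)) ∂Q i = ⊤ :=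
      fun i => (hQ i).lintegral_exp_eq_top _ (by rwa [hshift])
    rw [lintegral_exp_aggLaw, Finset.prod_congr rfl fun i _ => hfactor i, Finset.prod_const]
    exact ENNReal.top_pow (Finset.card_pos.2 ⟨j, by simp [hjk]⟩).ne'

theorem StochLE.aggLaw (hv : ∀ i, 0 ≤ v i) (h : ∀ i ∈ Finset.Icc j k, StochLE (Q i) (Q' i)) :
    StochLE (aggLaw v Q j k) (aggLaw v Q' j k) := by
  set w : Fin n → ℝ := fun i => v i / aggVol v j k
  have hw : ∀ i, Monotone fun x => w i * x := fun i =>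
    monotone_mul_left_of_nonneg (div_nonneg (hv i) (Finset.sum_nonneg fun l _ => hv l))
  have hsum : (fun y : Fin n → ℝ => aggMean v y j k) =
      ∑ i ∈ Finset.Icc j k, fun y : Fin n → ℝ => w i * y i := by
    ext y
    rw [aggMean_eq_sum, Finset.sum_apply]
  rw [EDF.aggLaw, EDF.aggLaw, hsum]
  refine StochLE.map_sum (iIndepFun_const_mul_eval Q w) (iIndepFun_const_mul_eval Q' w)
    (fun i => ((measurable_pi_apply i).const_mul _).aemeasurable)
    (fun i => ((measurable_pi_apply i).const_mul _).aemeasurable) _ fun i hi => ?_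
  rw [map_const_mul_eval, map_const_mul_eval]
  exact (h i hi).map (hw i) (by fun_prop)

end Pi

theorem isLaw_aggLaw_measureOf {ν : Fin n → Measure ℝ} {a : Fin n → ℝ → ℝ} {θ : ℝ}
    (hr : ∀ i, IsReference Θ κ (v i) φ (ν i) (a i)) (hv : ∀ i, 0 < v i) (hφ : 0 < φ)
    (hθ : θ ∈ Θ) (hjk : j ≤ k) :
    IsLaw Θ κ θ (aggVol v j k) φ
      (aggLaw v (fun i => measureOf κ θ (v i) φ (ν i) (a i)) j k) := by
  have := fun i => (hr i).isProbabilityMeasure hθ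
  exact (HasExpMoments.aggLaw (fun i => (hr i).hasExpMoments (hv i) hφ θ) hv hjk).isLaw hθ
    (aggVol_pos hv hjk) hφ

end Aggregation

section Band

variable {n : ℕ} (Θ : Set ℝ) (κ : ℝ → ℝ) (θ v : Fin n → ℝ) (φ : ℝ) (J : Finset (Fin n × Fin n))
  (α : ℝ) (i : Fin n)

theorem bandLower_eq_supIn_image (y : Fin n → ℝ) :
    bandLower Θ κ θ v φ J α y i = supIn (meanSpace Θ κ)
      ((fun p : Fin n × Fin n =>
        lower Θ κ (level J α) (aggVol v p.1 p.2) φ (aggMean v y p.1 p.2)) ''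
          {p | p ∈ J ∧ θ p.2 ≤ θ i}) := by
  unfold bandLower
  congr 1
  ext x
  simp only [mem_ofPred_eq, mem_image, and_assoc, eq_comm]

theorem bandUpper_eq_infIn_image (y : Fin n → ℝ) :
    bandUpper Θ κ θ v φ J α y i = infIn (meanSpace Θ κ)
      ((fun p : Fin n × Fin n =>
        upper Θ κ (level J α) (aggVol v p.1 p.2) φ (aggMean v y p.1 p.2)) ''
          {p | p ∈ J ∧ θ i ≤ θ p.1}) := by
  unfold bandUpper
  congr 1
  ext x
  simp only [mem_ofPred_eq, mem_image, and_assoc, eq_comm]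

theorem measurable_bandLower : Measurable fun y => bandLower Θ κ θ v φ J α y i := by
  simp only [bandLower_eq_supIn_image, supIn]
  by_cases hS : {p : Fin n × Fin n | p ∈ J ∧ θ p.2 ≤ θ i}.Nonempty
  · simp only [if_pos (hS.image _), sSup_image]
    exact Measurable.biSup _ (to_countable _) fun p _ =>
      (lower_mono _ _ _ _ _).measurable.comp (measurable_aggMean v p.1 p.2)
  · simp [not_nonempty_iff_eq_empty.1 hS]

theorem measurable_bandUpper : Measurable fun y => bandUpper Θ κ θ v φ J α y i := by
  simp only [bandUpper_eq_infIn_image, infIn]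
  by_cases hS : {p : Fin n × Fin n | p ∈ J ∧ θ i ≤ θ p.1}.Nonempty
  · simp only [if_pos (hS.image _), sInf_image]
    exact Measurable.biInf _ (to_countable _) fun p _ =>
      (upper_mono _ _ _ _ _).measurable.comp (measurable_aggMean v p.1 p.2)
  · simp [not_nonempty_iff_eq_empty.1 hS]

end Band

section Coverage

variable {Ω : Type*} [MeasurableSpace Ω] {P : Measure Ω} {Θ : Set ℝ} {κ : ℝ → ℝ} {n : ℕ}
  {θ v : Fin n → ℝ} {φ : ℝ} {J : Finset (Fin n × Fin n)} {α : ℝ} {N : Fin n → Ω → ℝ}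

theorem one_sub_sum_le_measureReal [IsProbabilityMeasure P] {ι : Type*} (s : Finset ι)
    (B : ι → Set Ω) {G : Set Ω}
    (hG : ∀ ω, (∀ p ∈ s, ω ∉ B p) → ω ∈ G) : 1 - ∑ p ∈ s, P.real (B p) ≤ P.real G := by
  have hcover : (univ : Set Ω) ⊆ G ∪ ⋃ p ∈ s, B p := fun ω _ => by
    by_cases hω : ∀ p ∈ s, ω ∉ B p
    · exact .inl (hG ω hω)
    · push Not at hω
      exact .inr (by simpa using hω)
  rw [sub_le_iff_le_add]
  calc (1 : ℝ) = P.real univ := probReal_univ.symm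
    _ ≤ P.real (G ∪ ⋃ p ∈ s, B p) := measureReal_mono hcover
    _ ≤ P.real G + P.real (⋃ p ∈ s, B p) := measureReal_union_le _ _
    _ ≤ P.real G + ∑ p ∈ s, P.real (B p) := by
      gcongr
      exact measureReal_biUnion_finset_le _ _

theorem level_nonneg (J : Finset (Fin n × Fin n)) (hα : 0 ≤ α) : 0 ≤ level J α := by
  unfold level
  positivity

theorem card_mul_two_mul_level_le (J : Finset (Fin n × Fin n)) (hα : 0 ≤ α) :
    J.card * (2 * level J α) ≤ α := by
  rcases J.eq_empty_or_nonempty with rfl | hne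
  · simpa using hα
  · have hcard : (J.card : ℝ) ≠ 0 := by exact_mod_cast hne.card_ne_zero
    rw [level]
    field_simp
    exact le_rfl

namespace IsAdditiveSample

theorem aemeasurable_response (h : IsAdditiveSample P Θ κ θ v φ N) (i : Fin n) :
    AEMeasurable (fun ω => response v φ (fun l => N l ω) i) P := by
  obtain ⟨ν, a, -, -, hlaw⟩ := h.hasLaw i
  exact hlaw.aemeasurable

theorem aemeasurable_response_pi (h : IsAdditiveSample P Θ κ θ v φ N) :
    AEMeasurable (fun ω => response v φ fun l => N l ω) P :=
  aemeasurable_pi_lambda _ h.aemeasurable_response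

theorem aemeasurable_aggMean_response (h : IsAdditiveSample P Θ κ θ v φ N) (j k : Fin n) :
    AEMeasurable (fun ω => aggMean v (response v φ fun l => N l ω) j k) P :=
  (measurable_aggMean v j k).comp_aemeasurable h.aemeasurable_response_pi

theorem aemeasurable_bandLower (h : IsAdditiveSample P Θ κ θ v φ N) (J : Finset (Fin n × Fin n))
    (α : ℝ) (i : Fin n) :
    AEMeasurable (fun ω => bandLower Θ κ θ v φ J α (response v φ fun l => N l ω) i) P :=
  (measurable_bandLower Θ κ θ v φ J α i).comp_aemeasurable h.aemeasurable_response_pi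

theorem aemeasurable_bandUpper (h : IsAdditiveSample P Θ κ θ v φ N) (J : Finset (Fin n × Fin n))
    (α : ℝ) (i : Fin n) :
    AEMeasurable (fun ω => bandUpper Θ κ θ v φ J α (response v φ fun l => N l ω) i) P :=
  (measurable_bandUpper Θ κ θ v φ J α i).comp_aemeasurable h.aemeasurable_response_pi

theorem integral_response (h : IsAdditiveSample P Θ κ θ v φ N) (hv : ∀ i, 0 < v i) (hφ : 0 < φ)
    (i : Fin n) : ∫ ω, response v φ (fun l => N l ω) i ∂P = deriv κ (θ i) := by
  obtain ⟨ν, a, hr, -, hlaw⟩ := h.hasLaw i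
  rw [hlaw.integral_eq, (hr.hasExpMoments (hv i) hφ _).deriv_eq (h.mem_interior i) (hv i) hφ]

theorem strictMonoOn_deriv (h : IsAdditiveSample P Θ κ θ v φ N) (hv : ∀ i, 0 < v i) (hφ : 0 < φ)
    (i : Fin n) : StrictMonoOn (deriv κ) (interior Θ) := by
  obtain ⟨ν, a, hr, hν, -⟩ := h.hasLaw i
  exact hr.strictMonoOn_deriv hν (hv i) hφ

theorem deriv_le_deriv_iff (h : IsAdditiveSample P Θ κ θ v φ N) (hv : ∀ i, 0 < v i) (hφ : 0 < φ)
    (i i' : Fin n) : deriv κ (θ i) ≤ deriv κ (θ i') ↔ θ i ≤ θ i' :=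
  (h.strictMonoOn_deriv hv hφ i).le_iff_le (h.mem_interior i) (h.mem_interior i')

variable [IsProbabilityMeasure P]

theorem map_aggMean_response (h : IsAdditiveSample P Θ κ θ v φ N) (j k : Fin n) :
    P.map (fun ω => aggMean v (response v φ fun l => N l ω) j k) =
      aggLaw v (fun i => P.map fun ω => response v φ (fun l => N l ω) i) j k := by
  have hindep : iIndepFun (fun i ω => response v φ (fun l => N l ω) i) P :=
    h.indep.comp (fun i x => φ * x / v i) fun i => by fun_prop
  rw [aggLaw, ← (iIndepFun_iff_map_fun_eq_pi_map h.aemeasurable_response).1 hindep,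
    AEMeasurable.map_map_of_aemeasurable (measurable_aggMean v j k).aemeasurable
      h.aemeasurable_response_pi]
  rfl

theorem exists_isLaw_stochLE (h : IsAdditiveSample P Θ κ θ v φ N) (hv : ∀ i, 0 < v i)
    (hφ : 0 < φ) {j k : Fin n} (hjk : j ≤ k) {θ₀ : ℝ} (hθ₀ : θ₀ ∈ Θ)
    (hle : ∀ i ∈ Finset.Icc j k, θ i ≤ θ₀) :
    ∃ Q, IsLaw Θ κ θ₀ (aggVol v j k) φ Q ∧
      StochLE (P.map fun ω => aggMean v (response v φ fun l => N l ω) j k) Q := by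
  choose ν a href using h.hasLaw
  have hr := fun i => (href i).1
  have hθ := fun i => interior_subset (h.mem_interior i)
  have := fun i => (hr i).isProbabilityMeasure (hθ i)
  have := fun i => (hr i).isProbabilityMeasure hθ₀
  refine ⟨_, isLaw_aggLaw_measureOf hr hv hφ hθ₀ hjk, ?_⟩
  simp only [h.map_aggMean_response, fun i => (href i).2.2.map_eq]
  exact StochLE.aggLaw (fun i => (hv i).le) fun i hi =>
    (hr i).stochLE (hv i) hφ (hθ i) hθ₀ (hle i hi)

theorem exists_isLaw_stochGE (h : IsAdditiveSample P Θ κ θ v φ N) (hv : ∀ i, 0 < v i)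
    (hφ : 0 < φ) {j k : Fin n} (hjk : j ≤ k) {θ₀ : ℝ} (hθ₀ : θ₀ ∈ Θ)
    (hle : ∀ i ∈ Finset.Icc j k, θ₀ ≤ θ i) :
    ∃ Q, IsLaw Θ κ θ₀ (aggVol v j k) φ Q ∧
      StochLE Q (P.map fun ω => aggMean v (response v φ fun l => N l ω) j k) := by
  choose ν a href using h.hasLaw
  have hr := fun i => (href i).1
  have hθ := fun i => interior_subset (h.mem_interior i)
  have := fun i => (hr i).isProbabilityMeasure (hθ i)
  have := fun i => (hr i).isProbabilityMeasure hθ₀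
  refine ⟨_, isLaw_aggLaw_measureOf hr hv hφ hθ₀ hjk, ?_⟩
  simp only [h.map_aggMean_response, fun i => (href i).2.2.map_eq]
  exact StochLE.aggLaw (fun i => (hv i).le) fun i hi =>
    (hr i).stochLE (hv i) hφ hθ₀ (hθ i) (hle i hi)

theorem measureReal_deriv_lt_lower_le (h : IsAdditiveSample P Θ κ θ v φ N) (hv : ∀ i, 0 < v i)
    (hφ : 0 < φ) (hθ : Monotone θ) {j k : Fin n} (hjk : j ≤ k) {δ : ℝ} (hδ : 0 ≤ δ) :
    P.real {ω | ((deriv κ (θ k) : ℝ) : EReal) < lower Θ κ δ (aggVol v j k) φ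
      (aggMean v (response v φ fun l => N l ω) j k)} ≤ δ := by
  obtain ⟨Q, hQ, hle⟩ := h.exists_isLaw_stochLE hv hφ hjk (interior_subset (h.mem_interior k))
    fun i hi => hθ (Finset.mem_Icc.1 hi).2
  exact EDF.measureReal_deriv_lt_lower_le (h.strictMonoOn_deriv hv hφ k).injOn (h.mem_interior k)
    hQ (h.aemeasurable_aggMean_response j k) hle hδ

theorem measureReal_upper_lt_deriv_le (h : IsAdditiveSample P Θ κ θ v φ N) (hv : ∀ i, 0 < v i)
    (hφ : 0 < φ) (hθ : Monotone θ) {j k : Fin n} (hjk : j ≤ k) {δ : ℝ} (hδ : 0 ≤ δ) :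
    P.real {ω | upper Θ κ δ (aggVol v j k) φ (aggMean v (response v φ fun l => N l ω) j k) <
      ((deriv κ (θ j) : ℝ) : EReal)} ≤ δ := by
  obtain ⟨Q, hQ, hle⟩ := h.exists_isLaw_stochGE hv hφ hjk (interior_subset (h.mem_interior j))
    fun i hi => hθ (Finset.mem_Icc.1 hi).1
  exact EDF.measureReal_upper_lt_deriv_le (h.strictMonoOn_deriv hv hφ j).injOn (h.mem_interior j)
    hQ (h.aemeasurable_aggMean_response j k) hle hδ

theorem coverage (h : IsAdditiveSample P Θ κ θ v φ N) (hv : ∀ i, 0 < v i) (hφ : 0 < φ)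
    (hJ : ∀ p ∈ J, p.1 ≤ p.2) (hα : 0 ≤ α) {μ : Fin n → ℝ}
    (hμ : ∀ i, ∫ ω, response v φ (fun l => N l ω) i ∂P = μ i) (hmono : Monotone μ) :
    1 - α ≤ P.real {ω | ∀ i,
      bandLower Θ κ θ v φ J α (response v φ fun l => N l ω) i ≤ (μ i : EReal) ∧
      (μ i : EReal) ≤ bandUpper Θ κ θ v φ J α (response v φ fun l => N l ω) i} := by
  obtain rfl : (fun i => deriv κ (θ i)) = μ :=
    funext fun i => (h.integral_response hv hφ i).symm.trans (hμ i)
  have hle := fun i i' => (h.deriv_le_deriv_iff hv hφ i i').2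
  have hθ : Monotone θ := fun i i' hi => (h.deriv_le_deriv_iff hv hφ i i').1 (hmono hi)
  have hmem : ∀ i, deriv κ (θ i) ∈ meanSpace Θ κ := fun i => ⟨θ i, h.mem_interior i, rfl⟩
  set B : Fin n × Fin n → Set Ω := fun p =>
    {ω | ((deriv κ (θ p.2) : ℝ) : EReal) < lower Θ κ (level J α) (aggVol v p.1 p.2) φ
      (aggMean v (response v φ fun l => N l ω) p.1 p.2)} ∪
    {ω | upper Θ κ (level J α) (aggVol v p.1 p.2) φ
      (aggMean v (response v φ fun l => N l ω) p.1 p.2) < ((deriv κ (θ p.1) : ℝ) : EReal)} with hB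
  have hlevel : ∀ p ∈ J, P.real (B p) ≤ 2 * level J α := fun p hp => by
    rw [two_mul]
    exact (measureReal_union_le _ _).trans (add_le_add
      (h.measureReal_deriv_lt_lower_le hv hφ hθ (hJ p hp) (level_nonneg J hα))
      (h.measureReal_upper_lt_deriv_le hv hφ hθ (hJ p hp) (level_nonneg J hα)))
  have hsum : ∑ p ∈ J, P.real (B p) ≤ α :=
    (Finset.sum_le_card_nsmul _ _ _ hlevel).trans
      (by simpa using card_mul_two_mul_level_le J hα)
  refine (sub_le_sub_left hsum 1).trans (one_sub_sum_le_measureReal J B fun ω hω i => ?_)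
  simp only [hB, mem_union, mem_ofPred_eq, not_or, not_lt] at hω
  refine ⟨supIn_le (hmem i) ?_, le_infIn (hmem i) ?_⟩
  · rintro _ ⟨p, hp, hpi, rfl⟩
    exact (hω p hp).1.trans (EReal.coe_le_coe_iff.2 (hle _ _ hpi))
  · rintro _ ⟨p, hp, hpi, rfl⟩
    exact (EReal.coe_le_coe_iff.2 (hle _ _ hpi)).trans (hω p hp).2

end IsAdditiveSample

end Coverage

section Quantile

variable {Q : Measure ℝ} [IsProbabilityMeasure Q] {S : Set ℝ} {q x : ℝ}

theorem quantile_le_iff (hq : q ∈ Ioo (0 : ℝ) 1) : quantile Q q ≤ x ↔ q ≤ Q.real (Iic x) := by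
  simp only [quantile, ← cdf_eq_real]
  have hbdd : BddBelow {x : ℝ | q ≤ cdf Q x} := by
    obtain ⟨a, ha⟩ := ((tendsto_cdf_atBot Q).eventually_lt_const hq.1).exists
    exact ⟨a, fun y hy => (monotone_cdf Q).reflect_lt (ha.trans_le hy) |>.le⟩
  have hne : {x : ℝ | q ≤ cdf Q x}.Nonempty := by
    obtain ⟨a, ha⟩ := ((tendsto_cdf_atTop Q).eventually_const_lt hq.2).exists
    exact ⟨a, ha.le⟩
  refine ⟨fun h => ?_, fun h => csInf_le hbdd h⟩
  refine ge_of_tendsto (((cdf Q).right_continuous x).mono Ioi_subset_Ici_self) ?_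
  filter_upwards [self_mem_nhdsWithin] with y hy
  obtain ⟨z, hz, hzy⟩ := exists_lt_of_csInf_lt hne (h.trans_lt hy)
  exact le_trans hz (monotone_cdf Q hzy.le)

theorem continuous_measureReal_Iic [NullSingletonClass Q] :
    Continuous fun x => Q.real (Iic x) := by
  simp only [← cdf_eq_real]
  refine continuous_iff_continuousAt.2 fun x => ?_
  rw [(monotone_cdf Q).continuousAt_iff_leftLim_eq_rightLim, StieltjesFunction.rightLim_eq]
  have hatom : Q {x} = 0 := measure_singleton x
  rw [← measure_cdf Q, StieltjesFunction.measure_singleton, ENNReal.ofReal_eq_zero,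
    sub_nonpos] at hatom
  exact le_antisymm ((monotone_cdf Q).leftLim_le le_rfl) hatom

theorem measureReal_Iic_quantile [NullSingletonClass Q] (hq : q ∈ Ioo (0 : ℝ) 1) :
    Q.real (Iic (quantile Q q)) = q := by
  refine le_antisymm ?_ ((quantile_le_iff hq).1 le_rfl)
  refine le_of_tendsto (continuous_measureReal_Iic.continuousWithinAt (s := Iio (quantile Q q))) ?_
  filter_upwards [self_mem_nhdsWithin] with y hy
  exact (not_le.1 fun h => hy.not_ge ((quantile_le_iff hq).2 h)).le

theorem mem_of_measureReal_Iic_mem_Ioo (hS : S.OrdConnected) (hQS : Q Sᶜ = 0)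
    (hx : Q.real (Iic x) ∈ Ioo (0 : ℝ) 1) : x ∈ S := by
  have hIic : (S ∩ Iic x).Nonempty := by
    by_contra! h
    refine hx.1.ne' ((measureReal_eq_zero_iff (by simp)).2 (measure_mono_null ?_ hQS))
    exact fun z hz hzS => h.subset ⟨hzS, hz⟩
  have hIoi : (S ∩ Ioi x).Nonempty := by
    by_contra! h
    have hnull : Q.real (Iic x)ᶜ = 0 := (measureReal_eq_zero_iff (by simp)).2
      (measure_mono_null (fun z (hz : ¬z ≤ x) (hzS : z ∈ S) => h.subset ⟨hzS, not_le.1 hz⟩) hQS)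
    rw [probReal_compl_eq_one_sub measurableSet_Iic] at hnull
    linarith [hx.2]
  obtain ⟨⟨y, hyS, hyx⟩, z, hzS, hxz⟩ := hIic, hIoi
  exact hS.out hyS hzS ⟨hyx, le_of_lt hxz⟩

theorem strictMonoOn_measureReal_Iic (hS : S.OrdConnected) (hSQ : volume.restrict S ≪ Q) :
    StrictMonoOn (fun x => Q.real (Iic x)) S := by
  intro y hy z hz hyz
  have hIoc : Q (Ioc y z) ≠ 0 := fun h0 => by
    have := hSQ h0
    rw [Measure.restrict_apply measurableSet_Ioc, inter_eq_left.2 fun w hw =>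
      hS.out hy hz ⟨hw.1.le, hw.2⟩] at this
    exact hyz.not_ge (by simpa using this)
  have hsplit : Q.real (Iic z) = Q.real (Iic y) + Q.real (Ioc y z) := by
    rw [← measureReal_union (Iic_disjoint_Ioc le_rfl) measurableSet_Ioc,
      Iic_union_Ioc_eq_Iic hyz.le]
  exact (lt_add_of_pos_right _ (ENNReal.toReal_pos hIoc (measure_ne_top _ _))).trans_eq hsplit.symm

theorem quantile_mem [NullSingletonClass Q] (hS : S.OrdConnected) (hQS : Q Sᶜ = 0)
    (hq : q ∈ Ioo (0 : ℝ) 1) : quantile Q q ∈ S :=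
  mem_of_measureReal_Iic_mem_Ioo hS hQS (by rwa [measureReal_Iic_quantile hq])

theorem le_quantile_iff [NullSingletonClass Q] (hS : S.OrdConnected) (hQS : Q Sᶜ = 0)
    (hSQ : volume.restrict S ≪ Q) (hq : q ∈ Ioo (0 : ℝ) 1) (hx : x ∈ S) :
    x ≤ quantile Q q ↔ Q.real (Iic x) ≤ q := by
  rw [← (strictMonoOn_measureReal_Iic hS hSQ).le_iff_le hx (quantile_mem hS hQS hq),
    measureReal_Iic_quantile hq]

end Quantile

section BetaGammaQuantile

variable {a b q x : ℝ}

instance nullSingletonClass_betaMeasure : NullSingletonClass (betaMeasure a b) :=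
  inferInstanceAs (NullSingletonClass (volume.withDensity _))

instance nullSingletonClass_gammaMeasure : NullSingletonClass (gammaMeasure a b) :=
  inferInstanceAs (NullSingletonClass (volume.withDensity _))

theorem restrict_absolutelyContinuous_withDensity {α : Type*} [MeasurableSpace α] {ν : Measure α}
    {f : α → ENNReal} {S : Set α} (hf : AEMeasurable f (ν.restrict S)) (hS : MeasurableSet S)
    (hfS : ∀ x ∈ S, f x ≠ 0) : ν.restrict S ≪ ν.withDensity f := by
  refine (withDensity_absolutelyContinuous' hf ?_).trans ?_
  · exact (ae_restrict_iff' hS).2 (ae_of_all _ hfS)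
  · rw [← restrict_withDensity hS]
    exact Measure.absolutelyContinuous_of_le Measure.restrict_le_self

theorem betaMeasure_compl_Ioo (a b : ℝ) : betaMeasure a b (Ioo 0 1)ᶜ = 0 := by
  refine (withDensity_apply_eq_zero' (measurable_betaPDFReal a b).ennreal_ofReal.aemeasurable).2 ?_
  refine measure_mono_null (t := ∅) (fun x hx => hx.1 ?_) measure_empty
  exact (betaPDF_eq a b x).trans
    (by rw [if_neg (show ¬(0 < x ∧ x < 1) from hx.2), ENNReal.ofReal_zero])

theorem restrict_Ioo_absolutelyContinuous_betaMeasure (ha : 0 < a) (hb : 0 < b) :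
    volume.restrict (Ioo 0 1) ≪ betaMeasure a b :=
  restrict_absolutelyContinuous_withDensity (measurable_betaPDFReal a b).ennreal_ofReal.aemeasurable
    measurableSet_Ioo fun _ hx => by simpa [betaPDF] using betaPDFReal_pos hx.1 hx.2 ha hb

theorem gammaMeasure_compl_Ioi (a b : ℝ) : gammaMeasure a b (Ioi 0)ᶜ = 0 := by
  refine (withDensity_apply_eq_zero' (measurable_gammaPDFReal a b).ennreal_ofReal.aemeasurable).2 ?_
  refine measure_mono_null (t := {0}) (fun x hx => ?_) (measure_singleton 0)
  by_contra hne
  exact hx.1 (gammaPDF_of_neg (lt_of_le_of_ne (not_lt.1 hx.2) hne))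

theorem restrict_Ioi_absolutelyContinuous_gammaMeasure (ha : 0 < a) (hb : 0 < b) :
    volume.restrict (Ioi 0) ≪ gammaMeasure a b :=
  restrict_absolutelyContinuous_withDensity
    (measurable_gammaPDFReal a b).ennreal_ofReal.aemeasurable
    measurableSet_Ioi fun _ hx => by simpa [gammaPDF] using gammaPDFReal_pos ha hb hx

theorem betaQuantile_mem_Ioo (ha : 0 < a) (hb : 0 < b) (hq : q ∈ Ioo (0 : ℝ) 1) :
    betaQuantile q a b ∈ Ioo (0 : ℝ) 1 := by
  have := isProbabilityMeasureBeta ha hb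
  exact quantile_mem ordConnected_Ioo (betaMeasure_compl_Ioo a b) hq

theorem betaQuantile_le_iff (ha : 0 < a) (hb : 0 < b) (hq : q ∈ Ioo (0 : ℝ) 1) :
    betaQuantile q a b ≤ x ↔ q ≤ (betaMeasure a b).real (Iic x) :=
  have := isProbabilityMeasureBeta ha hb
  quantile_le_iff hq

theorem le_betaQuantile_iff (ha : 0 < a) (hb : 0 < b) (hq : q ∈ Ioo (0 : ℝ) 1)
    (hx : x ∈ Ioo (0 : ℝ) 1) :
    x ≤ betaQuantile q a b ↔ (betaMeasure a b).real (Iic x) ≤ q :=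
  have := isProbabilityMeasureBeta ha hb
  le_quantile_iff ordConnected_Ioo (betaMeasure_compl_Ioo a b)
    (restrict_Ioo_absolutelyContinuous_betaMeasure ha hb) hq hx

theorem gammaQuantile_pos (ha : 0 < a) (hb : 0 < b) (hq : q ∈ Ioo (0 : ℝ) 1) :
    0 < gammaQuantile q a b := by
  have := isProbabilityMeasure_gammaMeasure ha (one_div_pos.2 hb)
  exact quantile_mem ordConnected_Ioi (gammaMeasure_compl_Ioi a (1 / b)) hq

theorem gammaQuantile_le_iff (ha : 0 < a) (hb : 0 < b) (hq : q ∈ Ioo (0 : ℝ) 1) :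
    gammaQuantile q a b ≤ x ↔ q ≤ (gammaMeasure a (1 / b)).real (Iic x) :=
  have := isProbabilityMeasure_gammaMeasure ha (one_div_pos.2 hb)
  quantile_le_iff hq

theorem le_gammaQuantile_iff (ha : 0 < a) (hb : 0 < b) (hq : q ∈ Ioo (0 : ℝ) 1) (hx : 0 < x) :
    x ≤ gammaQuantile q a b ↔ (gammaMeasure a (1 / b)).real (Iic x) ≤ q :=
  have := isProbabilityMeasure_gammaMeasure ha (one_div_pos.2 hb)
  le_quantile_iff ordConnected_Ioi (gammaMeasure_compl_Ioi a (1 / b))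
    (restrict_Ioi_absolutelyContinuous_gammaMeasure ha (one_div_pos.2 hb)) hq hx

end BetaGammaQuantile

section DistributionFunctions

theorem measureReal_Iic_withDensity_eq {f G : ℝ → ℝ} {c x : ℝ} (hf : Measurable f)
    (hf_lt : ∀ y < c, f y = 0) (hcx : c ≤ x) (hf_nonneg : ∀ y ∈ Ioo c x, 0 ≤ f y)
    (hG : ContinuousOn G (Icc c x)) (hG' : ∀ y ∈ Ioo c x, HasDerivAt G (f y) y) :
    (volume.withDensity fun y => ENNReal.ofReal (f y)).real (Iic x) = G x - G c := by
  have hint : IntervalIntegrable f volume c x := by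
    refine intervalIntegral.intervalIntegrable_deriv_of_nonneg (g := G) ?_ ?_ ?_
    · rwa [uIcc_of_le hcx]
    · simpa [hcx] using hG'
    · simpa [hcx] using hf_nonneg
  have hnonneg : 0 ≤ᵐ[volume.restrict (Ioc c x)] f := by
    rw [Filter.EventuallyLE, ← restrict_Ioo_eq_restrict_Ioc, ae_restrict_iff' measurableSet_Ioo]
    exact ae_of_all _ hf_nonneg
  have hIic : volume.withDensity (fun y => ENNReal.ofReal (f y)) (Iic c) = 0 := by
    rw [withDensity_apply_eq_zero' hf.ennreal_ofReal.aemeasurable]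
    refine measure_mono_null (t := {c}) (fun y hy => ?_) (measure_singleton c)
    by_contra hne
    exact hy.1 (by simp [hf_lt y (lt_of_le_of_ne hy.2 hne)])
  rw [measureReal_def, ← Iic_union_Ioc_eq_Iic hcx,
    measure_union (Iic_disjoint_Ioc le_rfl) measurableSet_Ioc, hIic, zero_add,
    withDensity_apply _ measurableSet_Ioc,
    ← integral_eq_lintegral_of_nonneg_ae hnonneg hf.aestronglyMeasurable,
    ← intervalIntegral.integral_of_le hcx,
    intervalIntegral.integral_eq_sub_of_hasDerivAt_of_le hcx hG hG' hint]

/-- The coefficients of the negative binomial distribution, that is of the binomial series of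
`(1 - x) ^ (-γ)`. -/
noncomputable def negBinCoeff (γ : ℝ) (l : ℕ) : ℝ :=
  Real.Gamma (l + γ) / (l.factorial * Real.Gamma γ)

theorem negBinCoeff_pos {γ : ℝ} (hγ : 0 < γ) (l : ℕ) : 0 < negBinCoeff γ l := by
  have := Real.Gamma_pos_of_pos hγ
  have : 0 < Real.Gamma (l + γ) := Real.Gamma_pos_of_pos (by positivity)
  unfold negBinCoeff
  positivity

theorem negBinCoeff_zero {γ : ℝ} (hγ : 0 < γ) : negBinCoeff γ 0 = 1 := by
  simp [negBinCoeff, (Real.Gamma_pos_of_pos hγ).ne']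

theorem negBinCoeff_succ {γ : ℝ} (hγ : 0 < γ) (l : ℕ) :
    (l + 1) * negBinCoeff γ (l + 1) = (l + γ) * negBinCoeff γ l := by
  have h1 := (Real.Gamma_pos_of_pos hγ).ne'
  have h2 : Real.Gamma (l + 1 + γ) = (l + γ) * Real.Gamma (l + γ) := by
    rw [← Real.Gamma_add_one (by positivity)]
    congr 1
    ring
  simp only [negBinCoeff, Nat.cast_add, Nat.cast_one, h2, Nat.factorial_succ, Nat.cast_mul]
  field_simp

theorem succ_mul_negBinCoeff_succ (γ : ℝ) (k : ℕ) :
    (k + 1) * negBinCoeff γ (k + 1) = 1 / beta (k + 1) γ := by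
  rw [negBinCoeff, beta, Real.Gamma_nat_eq_factorial, Nat.factorial_succ]
  push_cast
  rw [one_div_div]
  field_simp

theorem hasDerivAt_sum_negBinCoeff_mul_pow {γ : ℝ} (hγ : 0 < γ) {x : ℝ} (hx : x < 1) (K : ℕ) :
    HasDerivAt (fun p : ℝ => ∑ l ∈ Finset.range K, negBinCoeff γ l * p ^ l * (1 - p) ^ γ)
      (-(K * negBinCoeff γ K * x ^ (K - 1) * (1 - x) ^ (γ - 1))) x := by
  induction K with
  | zero => simpa using hasDerivAt_const x (0 : ℝ)
  | succ K ih =>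
    simp only [Finset.sum_range_succ]
    have hpow : (1 - x) ^ γ = (1 - x) * (1 - x) ^ (γ - 1) := by
      rw [← Real.rpow_one_add' (by linarith) (by simpa using hγ.ne')]
      congr 1
      ring
    have h1 : HasDerivAt (fun p : ℝ => (1 - p) ^ γ) (-1 * γ * (1 - x) ^ (γ - 1)) x :=
      ((hasDerivAt_id x).const_sub 1).rpow_const (Or.inl (by simp; linarith))
    refine (ih.add (((hasDerivAt_pow K x).const_mul (negBinCoeff γ K)).mul h1)).congr_deriv ?_
    have hK : (K : ℝ) * x ^ K = K * (x ^ (K - 1) * x) := by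
      rcases K with _ | K
      · simp
      · simp [pow_succ]
    have hc := negBinCoeff_succ hγ K
    simp only [Nat.cast_add, Nat.cast_one, Nat.add_sub_cancel, hc, hpow]
    linear_combination (negBinCoeff γ K * (1 - x) ^ (γ - 1)) * hK

theorem hasDerivAt_sum_choose_mul_pow (m : ℕ) (x : ℝ) (K : ℕ) :
    HasDerivAt (fun p : ℝ => ∑ l ∈ Finset.range K, (m.choose l : ℝ) * p ^ l * (1 - p) ^ (m - l))
      (-(K * m.choose K * x ^ (K - 1) * (1 - x) ^ (m - K))) x := by
  induction K with
  | zero => simpa using hasDerivAt_const x (0 : ℝ)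
  | succ K ih =>
    simp only [Finset.sum_range_succ]
    have h1 : HasDerivAt (fun p : ℝ => (1 - p) ^ (m - K))
        (((m - K : ℕ) : ℝ) * (1 - x) ^ (m - K - 1) * -1) x :=
      ((hasDerivAt_id x).const_sub 1).fun_pow (m - K)
    refine (ih.add (((hasDerivAt_pow K x).const_mul (m.choose K : ℝ)).mul h1)).congr_deriv ?_
    have hc : (m.choose (K + 1) : ℝ) * (K + 1) = m.choose K * (m - K : ℕ) := by
      exact_mod_cast Nat.choose_succ_right_eq m K
    simp only [Nat.cast_add, Nat.cast_one, Nat.add_sub_cancel, Nat.sub_sub]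
    linear_combination (x ^ K * (1 - x) ^ (m - (K + 1))) * hc

theorem hasDerivAt_sum_exp_neg_mul_pow (x : ℝ) (K : ℕ) :
    HasDerivAt (fun r : ℝ => ∑ l ∈ Finset.range K, Real.exp (-r) * r ^ l / l.factorial)
      (-(K / K.factorial * x ^ (K - 1) * Real.exp (-x))) x := by
  induction K with
  | zero => simpa using hasDerivAt_const x (0 : ℝ)
  | succ K ih =>
    simp only [Finset.sum_range_succ]
    have h1 : HasDerivAt (fun r : ℝ => Real.exp (-r)) (Real.exp (-x) * -1) x :=
      (hasDerivAt_neg x).exp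
    refine (ih.add ((h1.mul (hasDerivAt_pow K x)).div_const (K.factorial : ℝ))).congr_deriv ?_
    simp only [Nat.cast_add, Nat.cast_one, Nat.add_sub_cancel, Nat.factorial_succ, Nat.cast_mul]
    have : (K.factorial : ℝ) ≠ 0 := by positivity
    have : (K + 1 : ℝ) ≠ 0 := by positivity
    field_simp
    ring

theorem measureReal_Iic_betaMeasure {a b x : ℝ} {G : ℝ → ℝ} (ha : 0 < a) (hb : 0 < b)
    (hx : x ∈ Ioo (0 : ℝ) 1) (hG : ContinuousOn G (Icc 0 x))
    (hG' : ∀ y ∈ Ioo 0 x, HasDerivAt G (1 / beta a b * y ^ (a - 1) * (1 - y) ^ (b - 1)) y) :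
    (betaMeasure a b).real (Iic x) = G x - G 0 := by
  refine measureReal_Iic_withDensity_eq (f := betaPDFReal a b) (measurable_betaPDFReal a b)
    (fun y hy => ?_) hx.1.le (fun y hy => ?_) hG fun y hy => ?_
  · rw [betaPDFReal, if_neg (by simp [hy.le])]
  · exact (betaPDFReal_pos hy.1 (hy.2.trans hx.2) ha hb).le
  · rw [betaPDFReal, if_pos ⟨hy.1, hy.2.trans hx.2⟩]
    exact hG' y hy

theorem measureReal_Iic_gammaMeasure {a r x : ℝ} {G : ℝ → ℝ} (ha : 0 < a) (hr : 0 < r)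
    (hx : 0 ≤ x) (hG : ContinuousOn G (Icc 0 x))
    (hG' : ∀ y ∈ Ioo 0 x,
      HasDerivAt G (r ^ a / Real.Gamma a * y ^ (a - 1) * Real.exp (-(r * y))) y) :
    (gammaMeasure a r).real (Iic x) = G x - G 0 := by
  refine measureReal_Iic_withDensity_eq (f := gammaPDFReal a r) (measurable_gammaPDFReal a r)
    (fun y hy => ?_) hx (fun y _ => gammaPDFReal_nonneg ha hr y) hG fun y hy => ?_
  · rw [gammaPDFReal, if_neg (by simpa using hy)]
  · rw [gammaPDFReal, if_pos hy.1.le]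
    exact hG' y hy

theorem measureReal_Iic_betaMeasure_eq_one_sub_sum_negBinCoeff {γ : ℝ} (hγ : 0 < γ) (k : ℕ) {p : ℝ}
    (hp : p ∈ Ioo (0 : ℝ) 1) :
    (betaMeasure (k + 1) γ).real (Iic p) =
      1 - ∑ l ∈ Finset.range (k + 1), negBinCoeff γ l * p ^ l * (1 - p) ^ γ := by
  have hderiv : ∀ x < 1, HasDerivAt
      (fun p : ℝ => 1 - ∑ l ∈ Finset.range (k + 1), negBinCoeff γ l * p ^ l * (1 - p) ^ γ)
      (1 / beta (k + 1) γ * x ^ k * (1 - x) ^ (γ - 1)) x := fun x hx => by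
    rw [← succ_mul_negBinCoeff_succ]
    simpa using
      (hasDerivAt_sum_negBinCoeff_mul_pow hγ hx (k + 1)).const_sub 1
  rw [measureReal_Iic_betaMeasure (by positivity) hγ hp
    (fun x hx => (hderiv x (hx.2.trans_lt hp.2)).continuousAt.continuousWithinAt)
    fun x hx => by simpa using hderiv x (hx.2.trans hp.2)]
  simp [Finset.sum_range_succ', negBinCoeff_zero hγ]

theorem succ_mul_choose_succ (k d : ℕ) :
    ((k + 1) * (k + 1 + d).choose (k + 1) : ℝ) = 1 / beta (k + 1) (d + 1) := by
  have hkd : (k + 1 : ℝ) + (d + 1) = (k + 1 + d : ℕ) + 1 := by push_cast; ring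
  rw [beta, hkd, Real.Gamma_nat_eq_factorial, Real.Gamma_nat_eq_factorial,
    Real.Gamma_nat_eq_factorial, Nat.cast_add_choose, Nat.factorial_succ k]
  push_cast
  field_simp

theorem measureReal_Iic_betaMeasure_eq_one_sub_sum_choose {m k : ℕ} (hk : k < m) {p : ℝ}
    (hp : p ∈ Ioo (0 : ℝ) 1) :
    (betaMeasure (k + 1) (m - k)).real (Iic p) =
      1 - ∑ l ∈ Finset.range (k + 1), (m.choose l : ℝ) * p ^ l * (1 - p) ^ (m - l) := by
  obtain ⟨d, rfl⟩ := Nat.exists_eq_add_of_lt hk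
  rw [show ((k + d + 1 : ℕ) : ℝ) - k = d + 1 by push_cast; ring, add_right_comm k d 1]
  have hderiv (x : ℝ) : HasDerivAt
      (fun p : ℝ => 1 - ∑ l ∈ Finset.range (k + 1),
        ((k + 1 + d).choose l : ℝ) * p ^ l * (1 - p) ^ (k + 1 + d - l))
      (1 / beta (k + 1) (d + 1) * x ^ k * (1 - x) ^ d) x := by
    rw [← succ_mul_choose_succ]
    simpa using
      (hasDerivAt_sum_choose_mul_pow (k + 1 + d) x (k + 1)).const_sub 1
  rw [measureReal_Iic_betaMeasure (by positivity) (by positivity) hp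
    (fun x _ => (hderiv x).continuousAt.continuousWithinAt) fun x _ => by simpa using hderiv x]
  simp [Finset.sum_range_succ']

theorem measureReal_Iic_gammaMeasure_eq_one_sub_sum_exp (k : ℕ) {r : ℝ} (hr : 0 ≤ r) :
    (gammaMeasure (k + 1) 1).real (Iic r) =
      1 - ∑ l ∈ Finset.range (k + 1), Real.exp (-r) * r ^ l / l.factorial := by
  have hderiv (x : ℝ) : HasDerivAt
      (fun r : ℝ => 1 - ∑ l ∈ Finset.range (k + 1), Real.exp (-r) * r ^ l / l.factorial)
      (1 / k.factorial * x ^ k * Real.exp (-x)) x := by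
    refine ((hasDerivAt_sum_exp_neg_mul_pow x (k + 1)).const_sub 1).congr_deriv ?_
    rw [Nat.factorial_succ, neg_neg, Nat.add_sub_cancel]
    push_cast
    field_simp
  rw [measureReal_Iic_gammaMeasure (by positivity) one_pos hr
    (fun x _ => (hderiv x).continuousAt.continuousWithinAt)
    fun x _ => by simpa [Real.Gamma_nat_eq_factorial] using hderiv x]
  simp [Finset.sum_range_succ']

end DistributionFunctions

section NegBinomialSeries

theorem negBinCoeff_eq_ringChoose {γ : ℝ} (hγ : 0 < γ) (l : ℕ) :
    negBinCoeff γ l = Ring.choose (γ + l - 1) l := by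
  have h : ∀ l : ℕ, (l.factorial : ℝ) * negBinCoeff γ l = (ascPochhammer ℝ l).eval γ := by
    intro l
    induction l with
    | zero => simp [negBinCoeff_zero hγ]
    | succ l ih =>
      rw [ascPochhammer_succ_eval, ← ih, Nat.factorial_succ]
      push_cast
      linear_combination (l.factorial : ℝ) * negBinCoeff_succ hγ l
  have h2 := Ring.factorial_nsmul_multichoose_eq_ascPochhammer γ l
  rw [Polynomial.ascPochhammer_smeval_eq_eval, ← h l, nsmul_eq_mul, Ring.multichoose_eq] at h2
  exact (mul_left_cancel₀ (by positivity) h2).symm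

theorem hasSum_negBinCoeff {γ x : ℝ} (hγ : 0 < γ) (hx0 : 0 ≤ x) (hx1 : x < 1) :
    HasSum (fun l => negBinCoeff γ l * x ^ l) (1 / (1 - x) ^ γ) := by
  have h := (Real.one_div_one_sub_rpow_hasFPowerSeriesOnBall_zero γ).hasSum (y := x) (by
    rw [Metric.mem_eball, edist_dist, dist_zero_right, Real.norm_eq_abs, abs_of_nonneg hx0]
    simpa using hx1)
  simp only [FormalMultilinearSeries.ofScalars_apply_eq, smul_eq_mul, zero_add] at h
  simpa only [negBinCoeff_eq_ringChoose hγ] using h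

theorem tsum_ofReal_negBinCoeff_of_lt_one {γ x : ℝ} (hγ : 0 < γ) (hx0 : 0 ≤ x) (hx1 : x < 1) :
    ∑' l, ENNReal.ofReal (negBinCoeff γ l * x ^ l) = ENNReal.ofReal (1 / (1 - x) ^ γ) := by
  have h := hasSum_negBinCoeff hγ hx0 hx1
  rw [← h.tsum_eq, ENNReal.ofReal_tsum_of_nonneg
    (fun l => mul_nonneg (negBinCoeff_pos hγ l).le (by positivity)) h.summable]

theorem tsum_ofReal_negBinCoeff_of_one_le {γ x : ℝ} (hγ : 0 < γ) (hx : 1 ≤ x) :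
    ∑' l, ENNReal.ofReal (negBinCoeff γ l * x ^ l) = ⊤ := by
  have hlim : Filter.Tendsto (fun ε : ℝ => ENNReal.ofReal (ε ^ (-γ))) (nhdsWithin 0 (Ioi 0))
      (nhds ⊤) :=
    ENNReal.tendsto_ofReal_atTop.comp (tendsto_rpow_neg_nhdsGT_zero (neg_lt_zero.2 hγ))
  refine top_le_iff.1 (le_of_tendsto hlim ?_)
  filter_upwards [Ioo_mem_nhdsGT zero_lt_one] with ε hε
  have hsum := tsum_ofReal_negBinCoeff_of_lt_one (x := 1 - ε) hγ (by linarith [hε.2])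
    (by linarith [hε.1])
  rw [Real.rpow_neg hε.1.le, ← one_div, ← sub_sub_cancel 1 ε, ← hsum]
  refine ENNReal.tsum_le_tsum fun l => ENNReal.ofReal_le_ofReal ?_
  exact mul_le_mul_of_nonneg_left
    (pow_le_pow_left₀ (by linarith [hε.2]) (by linarith [hε.1]) l) (negBinCoeff_pos hγ l).le

theorem negBinomial_singleton (μ γ : ℝ) (l : ℕ) :
    negBinomial μ γ {l} =
      ENNReal.ofReal (negBinCoeff γ l * (μ / (1 + μ)) ^ l * (1 - μ / (1 + μ)) ^ γ) :=
  Measure.sum_smul_dirac_singleton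

theorem measureReal_negBinomial_singleton {μ γ : ℝ} (hμ : 0 < μ) (hγ : 0 < γ) (l : ℕ) :
    (negBinomial μ γ).real {l} =
      negBinCoeff γ l * (μ / (1 + μ)) ^ l * (1 - μ / (1 + μ)) ^ γ := by
  have h1 : 0 ≤ 1 - μ / (1 + μ) := by
    rw [sub_nonneg, div_le_one (by positivity)]
    linarith
  have := negBinCoeff_pos hγ l
  rw [measureReal_def, negBinomial_singleton, ENNReal.toReal_ofReal (by positivity)]

end NegBinomialSeries

section ExponentialMoments

variable {Θ : Set ℝ} {κ : ℝ → ℝ} {θ v φ : ℝ}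

theorem hasExpMoments_map_natCast {D : Measure ℕ}
    (h : ∀ s, θ + s ∈ Θ → ∫⁻ k : ℕ, ENNReal.ofReal (Real.exp (s * k)) ∂D =
      ENNReal.ofReal (Real.exp ((κ (θ + s) - κ θ) * (v / φ))))
    (h_top : ∀ s, θ + s ∉ Θ → ∫⁻ k : ℕ, ENNReal.ofReal (Real.exp (s * k)) ∂D = ⊤) :
    HasExpMoments Θ κ θ v φ (D.map fun k : ℕ => φ * k / v) := by
  have hmap (t : ℝ) : ∫⁻ y, ENNReal.ofReal (Real.exp (t * y)) ∂(D.map fun k : ℕ => φ * k / v) =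
      ∫⁻ k : ℕ, ENNReal.ofReal (Real.exp (t * (φ / v) * k)) ∂D := by
    rw [lintegral_map (by fun_prop) (by fun_prop)]
    refine lintegral_congr fun k => ?_
    congr 2
    ring
  refine ⟨fun t ht => ?_, fun t ht => by rw [hmap, h_top _ ht]⟩
  rw [hmap, h _ ht, div_div_eq_mul_div, mul_div_assoc]

theorem lintegral_exp_mul_binomial (m : ℕ) (p : unitInterval) (s : ℝ) :
    ∫⁻ k : ℕ, ENNReal.ofReal (Real.exp (s * k)) ∂binomial m p =
      ENNReal.ofReal ((p * Real.exp s + (1 - p)) ^ m) := by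
  rw [← ofReal_integral_eq_lintegral_ofReal (integrable_binomial _)
    (ae_of_all _ fun k => (Real.exp_pos _).le), integral_binomial, add_pow,
    ← Nat.range_succ_eq_Iic]
  congr 1
  refine Finset.sum_congr rfl fun k _ => ?_
  rw [smul_eq_mul, mul_pow, ← Real.exp_nat_mul, mul_comm s]
  ring

theorem lintegral_exp_mul_poissonMeasure (r : NNReal) (s : ℝ) :
    ∫⁻ k : ℕ, ENNReal.ofReal (Real.exp (s * k)) ∂poissonMeasure r =
      ENNReal.ofReal (Real.exp (r * (Real.exp s - 1))) := by
  have hterm (k : ℕ) : ENNReal.ofReal (Real.exp (s * k)) * poissonMeasure r {k} =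
      ENNReal.ofReal (Real.exp (-r) * ((r * Real.exp s) ^ k / k.factorial)) := by
    rw [poissonMeasure_singleton, ← ENNReal.ofReal_mul (Real.exp_pos _).le, mul_pow,
      ← Real.exp_nat_mul, mul_comm s]
    congr 1
    ring
  have hsum : HasSum (fun k : ℕ => Real.exp (-r) * ((r * Real.exp s) ^ k / k.factorial))
      (Real.exp (-r) * Real.exp (r * Real.exp s)) := by
    rw [Real.exp_eq_exp_ℝ]
    exact (NormedSpace.expSeries_div_hasSum_exp (r * NormedSpace.exp s)).mul_left _
  rw [lintegral_countable', tsum_congr hterm,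
    ← ENNReal.ofReal_tsum_of_nonneg (fun k => by positivity) hsum.summable, hsum.tsum_eq,
    ← Real.exp_add]
  ring_nf

theorem lintegral_exp_mul_negBinomial {μ γ : ℝ} (hμ : 0 ≤ μ) (s : ℝ) :
    ∫⁻ k : ℕ, ENNReal.ofReal (Real.exp (s * k)) ∂negBinomial μ γ =
      ENNReal.ofReal ((1 - μ / (1 + μ)) ^ γ) *
        ∑' k, ENNReal.ofReal (negBinCoeff γ k * (μ / (1 + μ) * Real.exp s) ^ k) := by
  have hp : 0 ≤ 1 - μ / (1 + μ) := by
    rw [sub_nonneg, div_le_one (by positivity)]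
    linarith
  rw [lintegral_countable', ← ENNReal.tsum_mul_left]
  refine tsum_congr fun k => ?_
  rw [negBinomial_singleton, ← ENNReal.ofReal_mul (Real.exp_pos _).le,
    ← ENNReal.ofReal_mul (by positivity), mul_pow, ← Real.exp_nat_mul, mul_comm s]
  congr 1
  ring

end ExponentialMoments

section MeanParametrizations

theorem sigmoid_log_div_one_sub {p : ℝ} (hp : p ∈ Ioo (0 : ℝ) 1) :
    Real.sigmoid (Real.log (p / (1 - p))) = p := by
  have := hp.1
  have h : 0 < 1 - p := sub_pos.2 hp.2
  rw [Real.sigmoid_def, Real.exp_neg, Real.exp_log (by positivity)]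
  field_simp
  ring

theorem div_one_add_mem_Ioo {μ : ℝ} (hμ : 0 < μ) : μ / (1 + μ) ∈ Ioo (0 : ℝ) 1 :=
  ⟨by positivity, by rw [div_lt_one (by positivity)]; linarith⟩

theorem log_div_one_add_neg {μ : ℝ} (hμ : 0 < μ) : Real.log (μ / (1 + μ)) < 0 :=
  Real.log_neg (div_one_add_mem_Ioo hμ).1 (div_one_add_mem_Ioo hμ).2

theorem div_one_sub_le_iff {q μ : ℝ} (hq : q < 1) (hμ : 0 < μ) :
    q / (1 - q) ≤ μ ↔ q ≤ μ / (1 + μ) := by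
  rw [div_le_iff₀ (sub_pos.2 hq), le_div_iff₀ (by positivity)]
  constructor <;> intro <;> linarith

theorem le_div_one_sub_iff {q μ : ℝ} (hq : q < 1) (hμ : 0 < μ) :
    μ ≤ q / (1 - q) ↔ μ / (1 + μ) ≤ q := by
  rw [le_div_iff₀ (sub_pos.2 hq), div_le_iff₀ (by positivity)]
  constructor <;> intro <;> linarith

theorem div_one_add_of_div_one_sub {q : ℝ} (hq : q < 1) :
    q / (1 - q) / (1 + q / (1 - q)) = q := by
  have : 0 < 1 - q := sub_pos.2 hq
  field_simp
  ring

theorem deriv_cumulantBin : deriv cumulantBin = Real.sigmoid := by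
  ext θ
  have he : (1 : ℝ) + Real.exp θ ≠ 0 := by positivity
  refine (((Real.hasDerivAt_exp θ).const_add 1).log he).deriv.trans ?_
  rw [Real.sigmoid_def, Real.exp_neg]
  field_simp
  ring

theorem meanSpace_cumulantBin : meanSpace univ cumulantBin = Ioo 0 1 := by
  rw [meanSpace, interior_univ, deriv_cumulantBin, image_univ, Real.range_sigmoid]

theorem injOn_deriv_cumulantBin : InjOn (deriv cumulantBin) (interior univ) := by
  rw [deriv_cumulantBin]
  exact Real.sigmoid_injective.injOn

theorem meanSpace_exp : meanSpace univ Real.exp = Ioi 0 := by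
  rw [meanSpace, interior_univ, Real.deriv_exp, image_univ, Real.range_exp]

theorem injOn_deriv_exp : InjOn (deriv Real.exp) (interior univ) := by
  rw [Real.deriv_exp]
  exact Real.exp_injective.injOn

theorem deriv_cumulantNegBin {θ : ℝ} (hθ : θ < 0) :
    deriv cumulantNegBin θ = Real.exp θ / (1 - Real.exp θ) := by
  have he : (1 : ℝ) - Real.exp θ ≠ 0 := (sub_pos.2 (Real.exp_lt_one_iff.2 hθ)).ne'
  refine ((((Real.hasDerivAt_exp θ).const_sub 1).log he).neg).deriv.trans ?_
  rw [neg_div, neg_neg]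

theorem deriv_cumulantNegBin_pos {θ : ℝ} (hθ : θ < 0) : 0 < deriv cumulantNegBin θ := by
  rw [deriv_cumulantNegBin hθ]
  exact div_pos (Real.exp_pos _) (sub_pos.2 (Real.exp_lt_one_iff.2 hθ))

theorem deriv_cumulantNegBin_div_one_add {θ : ℝ} (hθ : θ < 0) :
    deriv cumulantNegBin θ / (1 + deriv cumulantNegBin θ) = Real.exp θ := by
  rw [deriv_cumulantNegBin hθ, div_one_add_of_div_one_sub (Real.exp_lt_one_iff.2 hθ)]

theorem deriv_cumulantNegBin_log {μ : ℝ} (hμ : 0 < μ) :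
    deriv cumulantNegBin (Real.log (μ / (1 + μ))) = μ := by
  rw [deriv_cumulantNegBin (log_div_one_add_neg hμ), Real.exp_log (by positivity)]
  have : 0 < 1 + μ := by positivity
  field_simp
  ring

theorem meanSpace_cumulantNegBin : meanSpace (Iio 0) cumulantNegBin = Ioi 0 := by
  rw [meanSpace, interior_Iio]
  ext μ
  refine ⟨?_, fun hμ => ⟨_, log_div_one_add_neg hμ, deriv_cumulantNegBin_log hμ⟩⟩
  rintro ⟨θ, hθ, rfl⟩
  exact deriv_cumulantNegBin_pos hθ

theorem injOn_deriv_cumulantNegBin : InjOn (deriv cumulantNegBin) (interior (Iio 0)) := by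
  rw [interior_Iio]
  intro x hx y hy hxy
  apply Real.exp_injective
  rw [← deriv_cumulantNegBin_div_one_add hx, hxy, deriv_cumulantNegBin_div_one_add hy]

end MeanParametrizations

section CanonicalParametrizations

variable {θ v φ : ℝ}

theorem hasExpMoments_binomial {m : ℕ} (hm : v / φ = m) (θ : ℝ) :
    HasExpMoments univ cumulantBin θ v φ
      ((binomial m (unitInterval.sigmoid θ)).map fun k : ℕ => φ * k / v) := by
  refine hasExpMoments_map_natCast (fun s _ => ?_) fun s h => absurd (mem_univ _) h
  have hpgf : unitInterval.sigmoid θ * Real.exp s + (1 - unitInterval.sigmoid θ) =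
      (1 + Real.exp (θ + s)) / (1 + Real.exp θ) := by
    rw [show (unitInterval.sigmoid θ : ℝ) = Real.sigmoid θ from rfl, Real.sigmoid_def,
      Real.exp_neg, Real.exp_add]
    field_simp
    ring
  rw [lintegral_exp_mul_binomial, hpgf, hm, cumulantBin, cumulantBin,
    ← Real.log_div (by positivity) (by positivity), mul_comm (Real.log _), Real.exp_nat_mul,
    Real.exp_log (by positivity)]

theorem hasExpMoments_poisson (hv : 0 < v) (hφ : 0 < φ) (θ : ℝ) :
    HasExpMoments univ Real.exp θ v φ
      ((poissonMeasure (Real.exp θ * (v / φ)).toNNReal).map fun k : ℕ => φ * k / v) := by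
  refine hasExpMoments_map_natCast (fun s _ => ?_) fun s h => absurd (mem_univ _) h
  rw [lintegral_exp_mul_poissonMeasure, Real.coe_toNNReal _ (by positivity), Real.exp_add]
  ring_nf

theorem hasExpMoments_negBinomial (hv : 0 < v) (hφ : 0 < φ) (hθ : θ < 0) :
    HasExpMoments (Iio 0) cumulantNegBin θ v φ
      ((negBinomial (deriv cumulantNegBin θ) (v / φ)).map fun k : ℕ => φ * k / v) := by
  have hγ : 0 < v / φ := div_pos hv hφ
  have hlt : 0 < 1 - Real.exp θ := sub_pos.2 (Real.exp_lt_one_iff.2 hθ)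
  have hmgf (s : ℝ) := lintegral_exp_mul_negBinomial (γ := v / φ) (deriv_cumulantNegBin_pos hθ).le s
  simp only [deriv_cumulantNegBin_div_one_add hθ, ← Real.exp_add] at hmgf
  refine hasExpMoments_map_natCast (fun s hs => ?_) fun s hs => ?_
  · have hs' : Real.exp (θ + s) < 1 := Real.exp_lt_one_iff.2 hs
    have hlt' : 0 < 1 - Real.exp (θ + s) := sub_pos.2 hs'
    rw [hmgf, tsum_ofReal_negBinCoeff_of_lt_one hγ (Real.exp_pos _).le hs',
      ← ENNReal.ofReal_mul (by positivity), mul_one_div, ← Real.div_rpow hlt.le hlt'.le,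
      Real.rpow_def_of_pos (by positivity), Real.log_div hlt.ne' hlt'.ne', cumulantNegBin,
      cumulantNegBin]
    ring_nf
  · rw [hmgf, tsum_ofReal_negBinCoeff_of_one_le hγ (Real.one_le_exp (not_lt.1 hs))]
    exact ENNReal.mul_top (ENNReal.ofReal_pos.2 (Real.rpow_pos_of_pos hlt _)).ne'

end CanonicalParametrizations

section CountFamilies

variable {Θ M : Set ℝ} {κ : ℝ → ℝ} {v φ δ : ℝ} {pmf : ℝ → ℕ → ℝ}

/-- The members of an exponential dispersion family with mean space `M` are the images of
distributions on `ℕ` with probability mass functions `pmf μ`, `μ ∈ M`, under scaling by `φ / v`. -/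
structure IsCountFamily (Θ : Set ℝ) (κ : ℝ → ℝ) (M : Set ℝ) (v φ : ℝ) (pmf : ℝ → ℕ → ℝ) :
    Prop where
  meanSpace_eq : meanSpace Θ κ = M
  injOn_deriv : InjOn (deriv κ) (interior Θ)
  exists_measure : ∀ θ ∈ interior Θ, ∃ D : Measure ℕ, IsFiniteMeasure D ∧
    HasExpMoments Θ κ θ v φ (D.map fun k : ℕ => φ * k / v) ∧ ∀ l, D.real {l} = pmf (deriv κ θ) l

theorem measureReal_map_natCast_Iio (D : Measure ℕ) [IsFiniteMeasure D] (hv : 0 < v) (hφ : 0 < φ)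
    (K : ℕ) : (D.map fun k : ℕ => φ * k / v).real (Iio (φ * K / v)) =
      ∑ l ∈ Finset.range K, D.real {l} := by
  rw [map_measureReal_apply (by fun_prop) measurableSet_Iio, sum_measureReal_singleton]
  congr 1
  ext k
  simp only [mem_preimage, mem_Iio, Finset.coe_range]
  rw [div_lt_div_iff_of_pos_right hv, mul_lt_mul_iff_right₀ hφ, Nat.cast_lt]

theorem measureReal_map_natCast_Iic (D : Measure ℕ) [IsFiniteMeasure D] (hv : 0 < v) (hφ : 0 < φ)
    (K : ℕ) : (D.map fun k : ℕ => φ * k / v).real (Iic (φ * K / v)) =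
      ∑ l ∈ Finset.range (K + 1), D.real {l} := by
  rw [map_measureReal_apply (by fun_prop) measurableSet_Iic, sum_measureReal_singleton]
  congr 1
  ext k
  simp only [mem_preimage, mem_Iic, Finset.coe_range, mem_Iio, Nat.lt_succ_iff]
  rw [div_le_div_iff_of_pos_right hv, mul_le_mul_iff_right₀ hφ, Nat.cast_le]

namespace IsCountFamily

theorem exists_law_eq (h : IsCountFamily Θ κ M v φ pmf) (hv : 0 < v) (hφ : 0 < φ) {μ : ℝ}
    (hμ : μ ∈ M) : ∃ D : Measure ℕ, IsFiniteMeasure D ∧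
      law Θ κ (link Θ κ μ) v φ = D.map (fun k : ℕ => φ * k / v) ∧ ∀ l, D.real {l} = pmf μ l := by
  rw [← h.meanSpace_eq] at hμ
  obtain ⟨θ, hθ, rfl⟩ := hμ
  obtain ⟨D, hD, hmom, hpmf⟩ := h.exists_measure θ hθ
  exact ⟨D, hD, by rw [link_deriv h.injOn_deriv hθ, hmom.law_eq hθ hv hφ], hpmf⟩

theorem lower_eq (h : IsCountFamily Θ κ M v φ pmf) (hv : 0 < v) (hφ : 0 < φ) (δ : ℝ) (K : ℕ) :
    lower Θ κ δ v φ (φ * K / v) =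
      infIn M (Real.toEReal '' {μ | μ ∈ M ∧ ∑ l ∈ Finset.range K, pmf μ l ≤ 1 - δ}) := by
  rw [lower, h.meanSpace_eq]
  congr 2
  ext μ
  refine and_congr_right fun hμ => ?_
  obtain ⟨D, hD, hlaw, hpmf⟩ := h.exists_law_eq hv hφ hμ
  simp only [hlaw, measureReal_map_natCast_Iio D hv hφ, hpmf]

theorem upper_eq (h : IsCountFamily Θ κ M v φ pmf) (hv : 0 < v) (hφ : 0 < φ) (δ : ℝ) (K : ℕ) :
    upper Θ κ δ v φ (φ * K / v) =
      supIn M (Real.toEReal '' {μ | μ ∈ M ∧ δ ≤ ∑ l ∈ Finset.range (K + 1), pmf μ l}) := by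
  rw [upper, h.meanSpace_eq]
  congr 2
  ext μ
  refine and_congr_right fun hμ => ?_
  obtain ⟨D, hD, hlaw, hpmf⟩ := h.exists_law_eq hv hφ hμ
  simp only [hlaw, measureReal_map_natCast_Iic D hv hφ, hpmf]

theorem lower_zero_eq_of_isGLB (h : IsCountFamily Θ κ M v φ pmf) (hv : 0 < v) (hφ : 0 < φ)
    (hδ : δ ≤ 1) (hM : M.Nonempty) {r : ℝ} (hr : IsGLB M r) :
    lower Θ κ δ v φ (φ * (0 : ℕ) / v) = r := by
  have hset : {μ | μ ∈ M ∧ ∑ l ∈ Finset.range 0, pmf μ l ≤ 1 - δ} = M := by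
    ext μ
    simp [hδ]
  rw [h.lower_eq hv hφ, hset, infIn_eq_of_isGLB hM hr]

theorem lower_eq_of_le_iff (h : IsCountFamily Θ κ M v φ pmf) (hv : 0 < v) (hφ : 0 < φ)
    {K : ℕ} {r : ℝ} (hr : r ∈ M)
    (hiff : ∀ μ ∈ M, ∑ l ∈ Finset.range K, pmf μ l ≤ 1 - δ ↔ r ≤ μ) :
    lower Θ κ δ v φ (φ * K / v) = r := by
  have hl : IsLeast {μ | μ ∈ M ∧ ∑ l ∈ Finset.range K, pmf μ l ≤ 1 - δ} r :=
    ⟨⟨hr, (hiff r hr).2 le_rfl⟩, fun μ hμ => (hiff μ hμ.1).1 hμ.2⟩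
  rw [h.lower_eq hv hφ, infIn_eq_of_isGLB hl.nonempty hl.isGLB]

theorem upper_eq_of_le_iff (h : IsCountFamily Θ κ M v φ pmf) (hv : 0 < v) (hφ : 0 < φ)
    {K : ℕ} {r : ℝ} (hr : r ∈ M)
    (hiff : ∀ μ ∈ M, δ ≤ ∑ l ∈ Finset.range (K + 1), pmf μ l ↔ μ ≤ r) :
    upper Θ κ δ v φ (φ * K / v) = r := by
  have hl : IsGreatest {μ | μ ∈ M ∧ δ ≤ ∑ l ∈ Finset.range (K + 1), pmf μ l} r :=
    ⟨⟨hr, (hiff r hr).2 le_rfl⟩, fun μ hμ => (hiff μ hμ.1).1 hμ.2⟩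
  rw [h.upper_eq hv hφ, supIn_eq_of_isLUB hl.nonempty hl.isLUB]

end IsCountFamily

theorem HasExpMoments.isFiniteMeasure_of_map {θ : ℝ} {D : Measure ℕ}
    (h : HasExpMoments Θ κ θ v φ (D.map fun k : ℕ => φ * k / v)) (hθ : θ ∈ Θ) :
    IsFiniteMeasure D := by
  have hone := (h.isProbabilityMeasure hθ).measure_univ
  rw [Measure.map_apply (by fun_prop) MeasurableSet.univ, preimage_univ] at hone
  exact ⟨by rw [hone]; exact ENNReal.one_lt_top⟩

theorem one_sub_mem_Ioo (hδ : δ ∈ Ioo (0 : ℝ) 1) : 1 - δ ∈ Ioo (0 : ℝ) 1 :=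
  ⟨sub_pos.2 hδ.2, sub_lt_self _ hδ.1⟩

theorem mul_mul_natCast_div_div (hv : 0 < v) (hφ : 0 < φ) (K : ℕ) : v * (φ * K / v) / φ = K := by
  field_simp

end CountFamilies

section Binomial

variable {v φ δ : ℝ} {m K : ℕ}

theorem isCountFamily_binomial (hm : v / φ = m) :
    IsCountFamily univ cumulantBin (Ioo 0 1) v φ
      fun p l => (m.choose l : ℝ) * p ^ l * (1 - p) ^ (m - l) := by
  refine ⟨meanSpace_cumulantBin, injOn_deriv_cumulantBin, fun θ _ => ⟨_, inferInstance,
    hasExpMoments_binomial hm θ, fun l => ?_⟩⟩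
  rw [binomial_real_singleton, deriv_cumulantBin]
  rfl

theorem lower_binomial (hv : 0 < v) (hφ : 0 < φ) (hδ : δ ∈ Ioo (0 : ℝ) 1) (hm : v / φ = m)
    (hK : K ≤ m) :
    lower univ cumulantBin δ v φ (φ * K / v) = (lowerBin δ v φ (φ * K / v) : ℝ) := by
  have h := isCountFamily_binomial hm
  rcases K with _ | k
  · rw [h.lower_zero_eq_of_isGLB hv hφ hδ.2.le (nonempty_Ioo.2 one_pos) (isGLB_Ioo one_pos)]
    simp [lowerBin]
  have ha : (0 : ℝ) < k + 1 := by positivity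
  have hb : (0 : ℝ) < m - k := sub_pos.2 (Nat.cast_lt.2 hK)
  have hpos : 0 < φ * (k + 1 : ℕ) / v := by positivity
  have hval : lowerBin δ v φ (φ * (k + 1 : ℕ) / v) = betaQuantile δ (k + 1) (m - k) := by
    rw [lowerBin, indicator_of_mem (mem_ofPred_eq ▸ hpos), mul_mul_natCast_div_div hv hφ, hm,
      Pi.one_apply, mul_one, Nat.cast_succ, show (1 + m - (k + 1) : ℝ) = m - k by ring]
  rw [hval]
  refine h.lower_eq_of_le_iff hv hφ (betaQuantile_mem_Ioo ha hb hδ) fun μ hμ => ?_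
  rw [betaQuantile_le_iff ha hb hδ, measureReal_Iic_betaMeasure_eq_one_sub_sum_choose hK hμ,
    le_sub_comm]

theorem upper_binomial_of_lt (hv : 0 < v) (hφ : 0 < φ) (hδ : δ ∈ Ioo (0 : ℝ) 1) (hm : v / φ = m)
    (hK : K < m) :
    upper univ cumulantBin δ v φ (φ * K / v) = (upperBin δ v φ (φ * K / v) : ℝ) := by
  have ha : (0 : ℝ) < K + 1 := by positivity
  have hb : (0 : ℝ) < m - K := sub_pos.2 (Nat.cast_lt.2 hK)
  have hlt : φ * K / v < 1 := by
    rw [div_lt_one hv, ← lt_div_iff₀' hφ, hm]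
    exact_mod_cast hK
  have hval : upperBin δ v φ (φ * K / v) = betaQuantile (1 - δ) (K + 1) (m - K) := by
    rw [upperBin, indicator_of_mem (mem_ofPred_eq ▸ hlt),
      indicator_of_notMem (mem_ofPred_eq ▸ hlt.ne), mul_mul_natCast_div_div hv hφ, hm,
      Pi.one_apply, mul_one, add_zero, add_comm]
  rw [hval]
  refine (isCountFamily_binomial hm).upper_eq_of_le_iff hv hφ
    (betaQuantile_mem_Ioo ha hb (one_sub_mem_Ioo hδ)) fun μ hμ => ?_
  rw [le_betaQuantile_iff ha hb (one_sub_mem_Ioo hδ) hμ,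
    measureReal_Iic_betaMeasure_eq_one_sub_sum_choose hK hμ, sub_le_sub_iff_left]

theorem upper_binomial_self (hv : 0 < v) (hφ : 0 < φ) (hδ : δ ≤ 1) (hm : v / φ = m) :
    upper univ cumulantBin δ v φ (φ * m / v) = (upperBin δ v φ (φ * m / v) : ℝ) := by
  have hone : φ * m / v = 1 := by
    rw [← hm]
    field_simp
  have hset : {μ : ℝ | μ ∈ Ioo (0 : ℝ) 1 ∧ δ ≤ ∑ l ∈ Finset.range (m + 1),
      (m.choose l : ℝ) * μ ^ l * (1 - μ) ^ (m - l)} = Ioo 0 1 := by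
    ext μ
    have hsum : ∑ l ∈ Finset.range (m + 1), (m.choose l : ℝ) * μ ^ l * (1 - μ) ^ (m - l) = 1 := by
      have hpow := add_pow μ (1 - μ) m
      rw [add_sub_cancel, one_pow] at hpow
      exact (Finset.sum_congr rfl fun l _ => by ring).trans hpow.symm
    simp only [mem_ofPred_eq, hsum, hδ, and_true]
  rw [(isCountFamily_binomial hm).upper_eq hv hφ, hset,
    supIn_eq_of_isLUB (nonempty_Ioo.2 one_pos) (isLUB_Ioo one_pos)]
  simp [upperBin, hone]

theorem upper_binomial (hv : 0 < v) (hφ : 0 < φ) (hδ : δ ∈ Ioo (0 : ℝ) 1) (hm : v / φ = m)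
    (hK : K ≤ m) :
    upper univ cumulantBin δ v φ (φ * K / v) = (upperBin δ v φ (φ * K / v) : ℝ) := by
  rcases hK.lt_or_eq with hlt | rfl
  · exact upper_binomial_of_lt hv hφ hδ hm hlt
  · exact upper_binomial_self hv hφ hδ.2.le hm

end Binomial

section Poisson

variable {v φ δ : ℝ}

theorem isCountFamily_poisson (hv : 0 < v) (hφ : 0 < φ) :
    IsCountFamily univ Real.exp (Ioi 0) v φ
      fun μ l => Real.exp (-(μ * (v / φ))) * (μ * (v / φ)) ^ l / l.factorial := by
  refine ⟨meanSpace_exp, injOn_deriv_exp, fun θ _ => ⟨_, inferInstance,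
    hasExpMoments_poisson hv hφ θ, fun l => ?_⟩⟩
  rw [poissonMeasure_real_singleton, Real.deriv_exp, Real.coe_toNNReal _ (by positivity)]

theorem lower_poisson (hv : 0 < v) (hφ : 0 < φ) (hδ : δ ∈ Ioo (0 : ℝ) 1) (K : ℕ) :
    lower univ Real.exp δ v φ (φ * K / v) = (lowerPois δ v φ (φ * K / v) : ℝ) := by
  have h := isCountFamily_poisson hv hφ
  rcases K with _ | k
  · rw [h.lower_zero_eq_of_isGLB hv hφ hδ.2.le nonempty_Ioi isGLB_Ioi]
    simp [lowerPois]
  have ha : (0 : ℝ) < k + 1 := by positivity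
  have hpos : 0 < φ * (k + 1 : ℕ) / v := by positivity
  have hval : lowerPois δ v φ (φ * (k + 1 : ℕ) / v) = φ * gammaQuantile δ (k + 1) 1 / v := by
    rw [lowerPois, indicator_of_mem (mem_ofPred_eq ▸ hpos), mul_mul_natCast_div_div hv hφ,
      Pi.one_apply, mul_one, Nat.cast_succ]
  have hq := gammaQuantile_pos ha one_pos hδ
  rw [hval]
  refine h.lower_eq_of_le_iff hv hφ (mem_Ioi.2 (by positivity)) fun μ hμ => ?_
  have hμ' : 0 < μ * (v / φ) := mul_pos hμ (div_pos hv hφ)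
  rw [div_le_iff₀ hv, ← le_div_iff₀' hφ, mul_div_assoc, gammaQuantile_le_iff ha one_pos hδ,
    one_div_one, measureReal_Iic_gammaMeasure_eq_one_sub_sum_exp k hμ'.le, le_sub_comm]

theorem upper_poisson (hv : 0 < v) (hφ : 0 < φ) (hδ : δ ∈ Ioo (0 : ℝ) 1) (K : ℕ) :
    upper univ Real.exp δ v φ (φ * K / v) = (upperPois δ v φ (φ * K / v) : ℝ) := by
  have ha : (0 : ℝ) < K + 1 := by positivity
  have hq := gammaQuantile_pos ha one_pos (one_sub_mem_Ioo hδ)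
  rw [upperPois, mul_mul_natCast_div_div hv hφ, add_comm]
  refine (isCountFamily_poisson hv hφ).upper_eq_of_le_iff hv hφ (mem_Ioi.2 (by positivity))
    fun μ hμ => ?_
  have hμ' : 0 < μ * (v / φ) := mul_pos hμ (div_pos hv hφ)
  rw [le_div_iff₀ hv, ← div_le_iff₀' hφ, mul_div_assoc,
    le_gammaQuantile_iff ha one_pos (one_sub_mem_Ioo hδ) hμ', one_div_one,
    measureReal_Iic_gammaMeasure_eq_one_sub_sum_exp K hμ'.le, sub_le_sub_iff_left]

end Poisson

section NegativeBinomial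

variable {v φ δ : ℝ}

theorem isCountFamily_negBinomial (hv : 0 < v) (hφ : 0 < φ) :
    IsCountFamily (Iio 0) cumulantNegBin (Ioi 0) v φ fun μ l =>
      negBinCoeff (v / φ) l * (μ / (1 + μ)) ^ l * (1 - μ / (1 + μ)) ^ (v / φ) := by
  refine ⟨meanSpace_cumulantNegBin, injOn_deriv_cumulantNegBin, fun θ hθ => ?_⟩
  rw [interior_Iio] at hθ
  have hmom := hasExpMoments_negBinomial hv hφ hθ
  exact ⟨_, hmom.isFiniteMeasure_of_map hθ, hmom,
    measureReal_negBinomial_singleton (deriv_cumulantNegBin_pos hθ) (div_pos hv hφ)⟩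

theorem lower_negBinomial (hv : 0 < v) (hφ : 0 < φ) (hδ : δ ∈ Ioo (0 : ℝ) 1) (K : ℕ) :
    lower (Iio 0) cumulantNegBin δ v φ (φ * K / v) = (lowerNegBin δ v φ (φ * K / v) : ℝ) := by
  have h := isCountFamily_negBinomial hv hφ
  rcases K with _ | k
  · rw [h.lower_zero_eq_of_isGLB hv hφ hδ.2.le nonempty_Ioi isGLB_Ioi]
    simp [lowerNegBin]
  have ha : (0 : ℝ) < k + 1 := by positivity
  have hγ : 0 < v / φ := div_pos hv hφ
  have hpos : 0 < φ * (k + 1 : ℕ) / v := by positivity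
  have hval : lowerNegBin δ v φ (φ * (k + 1 : ℕ) / v) =
      betaQuantile δ (k + 1) (v / φ) / (1 - betaQuantile δ (k + 1) (v / φ)) := by
    rw [lowerNegBin, indicator_of_mem (mem_ofPred_eq ▸ hpos), mul_mul_natCast_div_div hv hφ,
      Pi.one_apply, mul_one, Nat.cast_succ]
  have hq := betaQuantile_mem_Ioo ha hγ hδ
  rw [hval]
  refine h.lower_eq_of_le_iff hv hφ (div_pos hq.1 (sub_pos.2 hq.2)) fun μ hμ => ?_
  rw [div_one_sub_le_iff hq.2 hμ, betaQuantile_le_iff ha hγ hδ,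
    measureReal_Iic_betaMeasure_eq_one_sub_sum_negBinCoeff hγ k (div_one_add_mem_Ioo hμ),
    le_sub_comm]

theorem upper_negBinomial (hv : 0 < v) (hφ : 0 < φ) (hδ : δ ∈ Ioo (0 : ℝ) 1) (K : ℕ) :
    upper (Iio 0) cumulantNegBin δ v φ (φ * K / v) = (upperNegBin δ v φ (φ * K / v) : ℝ) := by
  have ha : (0 : ℝ) < K + 1 := by positivity
  have hγ : 0 < v / φ := div_pos hv hφ
  have hq := betaQuantile_mem_Ioo ha hγ (one_sub_mem_Ioo hδ)
  rw [upperNegBin, mul_mul_natCast_div_div hv hφ, add_comm (1 : ℝ)]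
  refine (isCountFamily_negBinomial hv hφ).upper_eq_of_le_iff hv hφ
    (div_pos hq.1 (sub_pos.2 hq.2)) fun μ hμ => ?_
  rw [le_div_one_sub_iff hq.2 hμ,
    le_betaQuantile_iff ha hγ (one_sub_mem_Ioo hδ) (div_one_add_mem_Ioo hμ),
    measureReal_Iic_betaMeasure_eq_one_sub_sum_negBinCoeff hγ K (div_one_add_mem_Ioo hμ),
    sub_le_sub_iff_left]

end NegativeBinomial

section ExplicitBands

variable {Ω : Type*} [MeasurableSpace Ω] {P : Measure Ω} {Θ M : Set ℝ} {κ : ℝ → ℝ} {n : ℕ}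
  {θ v μ : Fin n → ℝ} {φ : ℝ} {J : Finset (Fin n × Fin n)} {α : ℝ}

theorem level_mem_Ioo (hα : α ∈ Ioo (0 : ℝ) 1) (hJ : J.Nonempty) : level J α ∈ Ioo (0 : ℝ) 1 := by
  have hcard : (1 : ℝ) ≤ J.card := by exact_mod_cast hJ.card_pos
  refine ⟨div_pos hα.1 (by positivity), ?_⟩
  rw [level, div_lt_one (by positivity)]
  linarith [hα.2]

theorem aggMean_response_natCast (hv : ∀ i, 0 < v i) (N : Fin n → ℕ) (j k : Fin n) :
    aggMean v (response v φ fun l => (N l : ℝ)) j k =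
      φ * (∑ i ∈ Finset.Icc j k, N i : ℕ) / aggVol v j k := by
  rw [aggMean, one_div_mul_eq_div, Nat.cast_sum, Finset.mul_sum]
  congr 1
  refine Finset.sum_congr rfl fun i _ => ?_
  rw [response, mul_div_cancel₀ _ (hv i).ne']

theorem bandLower_eq_explicitLower {l : ℝ → ℝ → ℝ → ℝ → ℝ} {y : Fin n → ℝ}
    (hM : meanSpace Θ κ = M) (hord : ∀ i i', θ i ≤ θ i' ↔ μ i ≤ μ i')
    (hl : ∀ p ∈ J, lower Θ κ (level J α) (aggVol v p.1 p.2) φ (aggMean v y p.1 p.2) =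
      (l (level J α) (aggVol v p.1 p.2) φ (aggMean v y p.1 p.2) : ℝ)) (i : Fin n) :
    bandLower Θ κ θ v φ J α y i = explicitLower M l μ v φ J α y i := by
  rw [bandLower, explicitLower, hM]
  congr 1
  ext x
  refine exists_congr fun p => and_congr_right fun hp => ?_
  rw [hord, hl p hp]

theorem bandUpper_eq_explicitUpper {u : ℝ → ℝ → ℝ → ℝ → ℝ} {y : Fin n → ℝ}
    (hM : meanSpace Θ κ = M) (hord : ∀ i i', θ i ≤ θ i' ↔ μ i ≤ μ i')
    (hu : ∀ p ∈ J, upper Θ κ (level J α) (aggVol v p.1 p.2) φ (aggMean v y p.1 p.2) =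
      (u (level J α) (aggVol v p.1 p.2) φ (aggMean v y p.1 p.2) : ℝ)) (i : Fin n) :
    bandUpper Θ κ θ v φ J α y i = explicitUpper M u μ v φ J α y i := by
  rw [bandUpper, explicitUpper, hM]
  congr 1
  ext x
  refine exists_congr fun p => and_congr_right fun hp => ?_
  rw [hord, hu p hp]

theorem isAdditiveSample_natCast {N : Fin n → Ω → ℕ} {D : Fin n → Measure ℕ} (hv : ∀ i, 0 < v i)
    (hφ : 0 < φ) (hΘ : (interior Θ).Nonempty) (hθ : ∀ i, θ i ∈ interior Θ) (hN : iIndepFun N P)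
    (hlaw : ∀ i, HasLaw (N i) (D i) P)
    (hmom : ∀ i, HasExpMoments Θ κ (θ i) (v i) φ ((D i).map fun k : ℕ => φ * k / v i))
    (hzero : ∀ i, (D i).real {0} ≠ 0) (hone : ∀ i, (D i).real {1} ≠ 0) :
    IsAdditiveSample P Θ κ θ v φ (fun i ω => (N i ω : ℝ)) := by
  refine ⟨hΘ, hθ, hN.comp (fun _ k => (k : ℝ)) fun _ => by fun_prop, fun i => ⟨_, _,
    (hmom i).isReference (interior_subset (hθ i)) (hv i) hφ, fun c hc => ?_, ?_⟩⟩
  · rw [Measure.map_apply (by fun_prop) (measurableSet_singleton c).compl] at hc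
    have hatom : ∀ k : ℕ, (D i).real {k} ≠ 0 → φ * k / v i = c := fun k hk => by
      by_contra hkc
      refine hk ?_
      rw [measureReal_def, measure_mono_null (singleton_subset_iff.2 hkc) hc, ENNReal.toReal_zero]
    have heq := (hatom 1 (hone i)).trans (hatom 0 (hzero i)).symm
    rw [Nat.cast_one, mul_one, Nat.cast_zero, mul_zero, zero_div] at heq
    exact (div_pos hφ (hv i)).ne' heq
  · rw [measureOf_selfNormalizer]
    exact HasLaw.comp (Y := fun k : ℕ => φ * k / v i) ⟨by fun_prop, rfl⟩ (hlaw i)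

theorem IsAdditiveSample.ae_bands_eq_explicit {N : Fin n → Ω → ℝ} {l u : ℝ → ℝ → ℝ → ℝ → ℝ}
    (h : IsAdditiveSample P Θ κ θ v φ N) (hv : ∀ i, 0 < v i) (hφ : 0 < φ)
    (hM : meanSpace Θ κ = M) (hμ : ∀ i, deriv κ (θ i) = μ i)
    (hlu : ∀ᵐ ω ∂P, ∀ p ∈ J,
      lower Θ κ (level J α) (aggVol v p.1 p.2) φ
          (aggMean v (response v φ fun i => N i ω) p.1 p.2) =
        (l (level J α) (aggVol v p.1 p.2) φ
          (aggMean v (response v φ fun i => N i ω) p.1 p.2) : ℝ) ∧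
      upper Θ κ (level J α) (aggVol v p.1 p.2) φ
          (aggMean v (response v φ fun i => N i ω) p.1 p.2) =
        (u (level J α) (aggVol v p.1 p.2) φ
          (aggMean v (response v φ fun i => N i ω) p.1 p.2) : ℝ)) :
    ∀ᵐ ω ∂P, ∀ i,
      bandLower Θ κ θ v φ J α (response v φ fun i => N i ω) i =
        explicitLower M l μ v φ J α (response v φ fun i => N i ω) i ∧
      bandUpper Θ κ θ v φ J α (response v φ fun i => N i ω) i =
        explicitUpper M u μ v φ J α (response v φ fun i => N i ω) i := by
  have hord : ∀ i i', θ i ≤ θ i' ↔ μ i ≤ μ i' := fun i i' => by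
    rw [← hμ, ← hμ, h.deriv_le_deriv_iff hv hφ]
  filter_upwards [hlu] with ω hω i
  exact ⟨bandLower_eq_explicitLower hM hord (fun p hp => (hω p hp).1) i,
    bandUpper_eq_explicitUpper hM hord (fun p hp => (hω p hp).2) i⟩

end ExplicitBands

section BinomialSample

variable {Ω : Type*} [MeasurableSpace Ω] {P : Measure Ω} {n : ℕ} {θ v : Fin n → ℝ} {φ : ℝ}
  {J : Finset (Fin n × Fin n)} {α : ℝ} {m : Fin n → ℕ} {μ : Fin n → unitInterval}
  {N : Fin n → Ω → ℕ}

theorem deriv_cumulantBin_logit {p : ℝ} (hp : p ∈ Ioo (0 : ℝ) 1) :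
    deriv cumulantBin (Real.log (p / (1 - p))) = p := by
  rw [deriv_cumulantBin, sigmoid_log_div_one_sub hp]

theorem isAdditiveSample_binomial (hv : ∀ i, 0 < v i) (hφ : 0 < φ) (hm : ∀ i, v i / φ = m i)
    (hμ : ∀ i, (μ i : ℝ) ∈ Ioo (0 : ℝ) 1) (hN : iIndepFun N P)
    (hlaw : ∀ i, HasLaw (N i) (binomial (m i) (μ i)) P)
    (hθ : ∀ i, θ i = Real.log (μ i / (1 - μ i))) :
    IsAdditiveSample P univ cumulantBin θ v φ fun i ω => (N i ω : ℝ) := by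
  have hsigmoid : ∀ i, unitInterval.sigmoid (θ i) = μ i := fun i =>
    Subtype.ext ((congrArg Real.sigmoid (hθ i)).trans (sigmoid_log_div_one_sub (hμ i)))
  have hm_pos : ∀ i, 0 < (m i : ℝ) := fun i => hm i ▸ div_pos (hv i) hφ
  have hfail : ∀ i, 0 < 1 - (μ i : ℝ) := fun i => sub_pos.2 (hμ i).2
  refine isAdditiveSample_natCast hv hφ (by simp) (fun i => by simp) hN hlaw
    (fun i => hsigmoid i ▸ hasExpMoments_binomial (hm i) (θ i)) (fun i => ?_) fun i => ?_
  · rw [binomial_real_zero]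
    exact (pow_pos (hfail i) _).ne'
  · rw [binomial_real_singleton, Nat.choose_one_right, pow_one]
    exact (mul_pos (mul_pos (hm_pos i) (hμ i).1) (pow_pos (hfail i) _)).ne'

theorem ae_bands_eq_explicit_binomial
    (h : IsAdditiveSample P univ cumulantBin θ v φ fun i ω => (N i ω : ℝ)) (hv : ∀ i, 0 < v i)
    (hφ : 0 < φ) (hJ : ∀ p ∈ J, p.1 ≤ p.2) (hα : α ∈ Ioo (0 : ℝ) 1) (hm : ∀ i, v i / φ = m i)
    (hlaw : ∀ i, HasLaw (N i) (binomial (m i) (μ i)) P)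
    (hμ : ∀ i, deriv cumulantBin (θ i) = μ i) :
    ∀ᵐ ω ∂P, ∀ i,
      bandLower univ cumulantBin θ v φ J α (response v φ fun i => (N i ω : ℝ)) i =
        explicitLower (Ioo 0 1) lowerBin (fun i => (μ i : ℝ)) v φ J α
          (response v φ fun i => (N i ω : ℝ)) i ∧
      bandUpper univ cumulantBin θ v φ J α (response v φ fun i => (N i ω : ℝ)) i =
        explicitUpper (Ioo 0 1) upperBin (fun i => (μ i : ℝ)) v φ J α
          (response v φ fun i => (N i ω : ℝ)) i := by
  refine h.ae_bands_eq_explicit hv hφ meanSpace_cumulantBin hμ ?_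
  filter_upwards [ae_all_iff.2 fun i => ae_le_of_hasLaw_binomial (hlaw i)] with ω hω
  rintro ⟨j, k⟩ hp
  have hδ := level_mem_Ioo hα ⟨_, hp⟩
  have hV := aggVol_pos hv (hJ _ hp)
  have htrials : aggVol v j k / φ = (∑ i ∈ Finset.Icc j k, m i : ℕ) := by
    rw [aggVol, Finset.sum_div, Nat.cast_sum]
    exact Finset.sum_congr rfl fun i _ => hm i
  have hle := Finset.sum_le_sum fun i (_ : i ∈ Finset.Icc j k) => hω i
  rw [aggMean_response_natCast hv]
  exact ⟨lower_binomial hV hφ hδ htrials hle, upper_binomial hV hφ hδ htrials hle⟩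

end BinomialSample

section PoissonSample

variable {Ω : Type*} [MeasurableSpace Ω] {P : Measure Ω} {n : ℕ} {θ v μ : Fin n → ℝ} {φ : ℝ}
  {J : Finset (Fin n × Fin n)} {α : ℝ} {N : Fin n → Ω → ℕ}

theorem isAdditiveSample_poisson (hv : ∀ i, 0 < v i) (hφ : 0 < φ) (hμ : ∀ i, 0 < μ i)
    (hN : iIndepFun N P) (hlaw : ∀ i, HasLaw (N i) (poissonMeasure (μ i * v i / φ).toNNReal) P)
    (hθ : ∀ i, θ i = Real.log (μ i)) :
    IsAdditiveSample P univ Real.exp θ v φ fun i ω => (N i ω : ℝ) := by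
  have hrate : ∀ i, μ i * v i / φ = Real.exp (θ i) * (v i / φ) := fun i => by
    rw [hθ, Real.exp_log (hμ i), mul_div_assoc]
  have hpos : ∀ i, 0 < (μ i * v i / φ).toNNReal := fun i =>
    Real.toNNReal_pos.2 (div_pos (mul_pos (hμ i) (hv i)) hφ)
  exact isAdditiveSample_natCast hv hφ (by simp) (fun i => by simp) hN hlaw
    (fun i => hrate i ▸ hasExpMoments_poisson (hv i) hφ (θ i))
    (fun i => (poissonMeasure_real_singleton_pos 0 (hpos i)).ne')
    fun i => (poissonMeasure_real_singleton_pos 1 (hpos i)).ne'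

theorem ae_bands_eq_explicit_poisson
    (h : IsAdditiveSample P univ Real.exp θ v φ fun i ω => (N i ω : ℝ)) (hv : ∀ i, 0 < v i)
    (hφ : 0 < φ) (hJ : ∀ p ∈ J, p.1 ≤ p.2) (hα : α ∈ Ioo (0 : ℝ) 1)
    (hμ : ∀ i, deriv Real.exp (θ i) = μ i) :
    ∀ᵐ ω ∂P, ∀ i,
      bandLower univ Real.exp θ v φ J α (response v φ fun i => (N i ω : ℝ)) i =
        explicitLower (Ioi 0) lowerPois μ v φ J α (response v φ fun i => (N i ω : ℝ)) i ∧
      bandUpper univ Real.exp θ v φ J α (response v φ fun i => (N i ω : ℝ)) i =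
        explicitUpper (Ioi 0) upperPois μ v φ J α (response v φ fun i => (N i ω : ℝ)) i := by
  refine h.ae_bands_eq_explicit hv hφ meanSpace_exp hμ (ae_of_all _ fun ω p hp => ?_)
  have hδ := level_mem_Ioo hα ⟨p, hp⟩
  have hV := aggVol_pos hv (hJ p hp)
  rw [aggMean_response_natCast hv]
  exact ⟨lower_poisson hV hφ hδ _, upper_poisson hV hφ hδ _⟩

end PoissonSample

section NegativeBinomialSample

variable {Ω : Type*} [MeasurableSpace Ω] {P : Measure Ω} {n : ℕ} {θ v μ : Fin n → ℝ} {φ : ℝ}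
  {J : Finset (Fin n × Fin n)} {α : ℝ} {N : Fin n → Ω → ℕ}

theorem measureReal_negBinomial_singleton_pos {μ γ : ℝ} (hμ : 0 < μ) (hγ : 0 < γ) (l : ℕ) :
    0 < (negBinomial μ γ).real {l} := by
  have hp := div_one_add_mem_Ioo hμ
  rw [measureReal_negBinomial_singleton hμ hγ]
  exact mul_pos (mul_pos (negBinCoeff_pos hγ l) (pow_pos hp.1 l))
    (Real.rpow_pos_of_pos (sub_pos.2 hp.2) _)

theorem isAdditiveSample_negBinomial (hv : ∀ i, 0 < v i) (hφ : 0 < φ) (hμ : ∀ i, 0 < μ i)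
    (hN : iIndepFun N P) (hlaw : ∀ i, HasLaw (N i) (negBinomial (μ i) (v i / φ)) P)
    (hθ : ∀ i, θ i = Real.log (μ i / (1 + μ i))) :
    IsAdditiveSample P (Iio 0) cumulantNegBin θ v φ fun i ω => (N i ω : ℝ) := by
  have hneg : ∀ i, θ i < 0 := fun i => hθ i ▸ log_div_one_add_neg (hμ i)
  have hmean : ∀ i, deriv cumulantNegBin (θ i) = μ i := fun i => by
    rw [hθ, deriv_cumulantNegBin_log (hμ i)]
  have hatom := fun i => measureReal_negBinomial_singleton_pos (hμ i) (div_pos (hv i) hφ)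
  exact isAdditiveSample_natCast hv hφ (by simp) (fun i => by simpa using hneg i) hN hlaw
    (fun i => hmean i ▸ hasExpMoments_negBinomial (hv i) hφ (hneg i))
    (fun i => (hatom i 0).ne') fun i => (hatom i 1).ne'

theorem ae_bands_eq_explicit_negBinomial
    (h : IsAdditiveSample P (Iio 0) cumulantNegBin θ v φ fun i ω => (N i ω : ℝ))
    (hv : ∀ i, 0 < v i) (hφ : 0 < φ) (hJ : ∀ p ∈ J, p.1 ≤ p.2) (hα : α ∈ Ioo (0 : ℝ) 1)
    (hμ : ∀ i, deriv cumulantNegBin (θ i) = μ i) :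
    ∀ᵐ ω ∂P, ∀ i,
      bandLower (Iio 0) cumulantNegBin θ v φ J α (response v φ fun i => (N i ω : ℝ)) i =
        explicitLower (Ioi 0) lowerNegBin μ v φ J α (response v φ fun i => (N i ω : ℝ)) i ∧
      bandUpper (Iio 0) cumulantNegBin θ v φ J α (response v φ fun i => (N i ω : ℝ)) i =
        explicitUpper (Ioi 0) upperNegBin μ v φ J α (response v φ fun i => (N i ω : ℝ)) i := by
  refine h.ae_bands_eq_explicit hv hφ meanSpace_cumulantNegBin hμ (ae_of_all _ fun ω p hp => ?_)
  have hδ := level_mem_Ioo hα ⟨p, hp⟩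
  have hV := aggVol_pos hv (hJ p hp)
  rw [aggMean_response_natCast hv]
  exact ⟨lower_negBinomial hV hφ hδ _, upper_negBinomial hV hφ hδ _⟩

end NegativeBinomialSample

end EDF

theorem mainTheorem4 {Ω : Type*} [MeasurableSpace Ω] (P : Measure Ω) [IsProbabilityMeasure P]
    {n : ℕ} (v : Fin n → ℝ) (hv : ∀ i, 0 < v i) (φ : ℝ) (hφ : 0 < φ)
    (J : Finset (Fin n × Fin n)) (hJ : ∀ p ∈ J, p.1 ≤ p.2) (α : ℝ) (hα : α ∈ Ioo (0 : ℝ) 1) :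
    -- coverage for the additive form of a general exponential dispersion family
    (∀ (Θ : Set ℝ) (κ : ℝ → ℝ) (θ : Fin n → ℝ) (N : Fin n → Ω → ℝ) (Y : Fin n → Ω → ℝ),
      (∀ i ω, Y i ω = EDF.response v φ (fun l => N l ω) i) →
      EDF.IsAdditiveSample P Θ κ θ v φ N →
      Monotone (fun i => ∫ ω, Y i ω ∂P) →
      (∀ i, AEMeasurable (fun ω => EDF.bandLower Θ κ θ v φ J α (fun l => Y l ω) i) P) ∧
      (∀ i, AEMeasurable (fun ω => EDF.bandUpper Θ κ θ v φ J α (fun l => Y l ω) i) P) ∧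
      1 - α ≤ P.real {ω | ∀ i,
        EDF.bandLower Θ κ θ v φ J α (fun l => Y l ω) i ≤ ((∫ ω', Y i ω' ∂P : ℝ) : EReal) ∧
        ((∫ ω', Y i ω' ∂P : ℝ) : EReal) ≤ EDF.bandUpper Θ κ θ v φ J α (fun l => Y l ω) i}) ∧
    -- binomial case
    (∀ (m : Fin n → ℕ) (μ : Fin n → unitInterval) (N : Fin n → Ω → ℕ) (θ : Fin n → ℝ)
      (Y : Fin n → Ω → ℝ),
      (∀ i, v i / φ = m i) → (∀ i, (μ i : ℝ) ∈ Ioo (0 : ℝ) 1) → Monotone μ →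
      iIndepFun N P → (∀ i, HasLaw (N i) (binomial (m i) (μ i)) P) →
      (∀ i, θ i = Real.log (μ i / (1 - μ i))) →
      (∀ i ω, Y i ω = EDF.response v φ (fun l => (N l ω : ℝ)) i) →
      EDF.IsAdditiveSample P univ EDF.cumulantBin θ v φ (fun i ω => (N i ω : ℝ)) ∧
      (∀ i, ∫ ω, Y i ω ∂P = μ i) ∧
      1 - α ≤ P.real {ω | ∀ i,
        EDF.bandLower univ EDF.cumulantBin θ v φ J α (fun l => Y l ω) i ≤ ((μ i : ℝ) : EReal) ∧
        ((μ i : ℝ) : EReal) ≤ EDF.bandUpper univ EDF.cumulantBin θ v φ J α (fun l => Y l ω) i} ∧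
      ∀ᵐ ω ∂P, ∀ i,
        EDF.bandLower univ EDF.cumulantBin θ v φ J α (fun l => Y l ω) i =
          EDF.explicitLower (Ioo 0 1) EDF.lowerBin (fun l => (μ l : ℝ)) v φ J α
            (fun l => Y l ω) i ∧
        EDF.bandUpper univ EDF.cumulantBin θ v φ J α (fun l => Y l ω) i =
          EDF.explicitUpper (Ioo 0 1) EDF.upperBin (fun l => (μ l : ℝ)) v φ J α
            (fun l => Y l ω) i) ∧
    -- Poisson case
    (∀ (μ : Fin n → ℝ) (N : Fin n → Ω → ℕ) (θ : Fin n → ℝ) (Y : Fin n → Ω → ℝ),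
      (∀ i, 0 < μ i) → Monotone μ →
      iIndepFun N P → (∀ i, HasLaw (N i) (poissonMeasure (μ i * v i / φ).toNNReal) P) →
      (∀ i, θ i = Real.log (μ i)) →
      (∀ i ω, Y i ω = EDF.response v φ (fun l => (N l ω : ℝ)) i) →
      EDF.IsAdditiveSample P univ Real.exp θ v φ (fun i ω => (N i ω : ℝ)) ∧
      (∀ i, ∫ ω, Y i ω ∂P = μ i) ∧
      1 - α ≤ P.real {ω | ∀ i,
        EDF.bandLower univ Real.exp θ v φ J α (fun l => Y l ω) i ≤ (μ i : EReal) ∧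
        (μ i : EReal) ≤ EDF.bandUpper univ Real.exp θ v φ J α (fun l => Y l ω) i} ∧
      ∀ᵐ ω ∂P, ∀ i,
        EDF.bandLower univ Real.exp θ v φ J α (fun l => Y l ω) i =
          EDF.explicitLower (Ioi 0) EDF.lowerPois μ v φ J α (fun l => Y l ω) i ∧
        EDF.bandUpper univ Real.exp θ v φ J α (fun l => Y l ω) i =
          EDF.explicitUpper (Ioi 0) EDF.upperPois μ v φ J α (fun l => Y l ω) i) ∧
    -- negative binomial case
    (∀ (μ : Fin n → ℝ) (N : Fin n → Ω → ℕ) (θ : Fin n → ℝ) (Y : Fin n → Ω → ℝ),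
      (∀ i, 0 < μ i) → Monotone μ →
      iIndepFun N P → (∀ i, HasLaw (N i) (EDF.negBinomial (μ i) (v i / φ)) P) →
      (∀ i, θ i = Real.log (μ i / (1 + μ i))) →
      (∀ i ω, Y i ω = EDF.response v φ (fun l => (N l ω : ℝ)) i) →
      EDF.IsAdditiveSample P (Iio 0) EDF.cumulantNegBin θ v φ (fun i ω => (N i ω : ℝ)) ∧
      (∀ i, ∫ ω, Y i ω ∂P = μ i) ∧
      1 - α ≤ P.real {ω | ∀ i,
        EDF.bandLower (Iio 0) EDF.cumulantNegBin θ v φ J α (fun l => Y l ω) i ≤ (μ i : EReal) ∧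
        (μ i : EReal) ≤ EDF.bandUpper (Iio 0) EDF.cumulantNegBin θ v φ J α (fun l => Y l ω) i} ∧
      ∀ᵐ ω ∂P, ∀ i,
        EDF.bandLower (Iio 0) EDF.cumulantNegBin θ v φ J α (fun l => Y l ω) i =
          EDF.explicitLower (Ioi 0) EDF.lowerNegBin μ v φ J α (fun l => Y l ω) i ∧
        EDF.bandUpper (Iio 0) EDF.cumulantNegBin θ v φ J α (fun l => Y l ω) i =
          EDF.explicitUpper (Ioi 0) EDF.upperNegBin μ v φ J α (fun l => Y l ω) i) := by
  refine ⟨fun Θ κ θ N Y hY hs hmono => ?_, fun m μ N θ Y hm hμ hmono hN hlaw hθ hY => ?_,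
    fun μ N θ Y hμ hmono hN hlaw hθ hY => ?_, fun μ N θ Y hμ hmono hN hlaw hθ hY => ?_⟩ <;>
    obtain rfl : Y = _ := funext₂ hY
  · exact ⟨hs.aemeasurable_bandLower J α, hs.aemeasurable_bandUpper J α,
      hs.coverage hv hφ hJ hα.1.le (fun _ => rfl) hmono⟩
  · have hs := EDF.isAdditiveSample_binomial hv hφ hm hμ hN hlaw hθ
    have hderiv : ∀ i, deriv EDF.cumulantBin (θ i) = μ i := fun i => by
      rw [hθ, EDF.deriv_cumulantBin_logit (hμ i)]
    have hmean := fun i => (hs.integral_response hv hφ i).trans (hderiv i)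
    exact ⟨hs, hmean, hs.coverage hv hφ hJ hα.1.le hmean fun _ _ h => hmono h,
      EDF.ae_bands_eq_explicit_binomial hs hv hφ hJ hα hm hlaw hderiv⟩
  · have hs := EDF.isAdditiveSample_poisson hv hφ hμ hN hlaw hθ
    have hderiv : ∀ i, deriv Real.exp (θ i) = μ i := fun i => by
      rw [Real.deriv_exp, hθ, Real.exp_log (hμ i)]
    have hmean := fun i => (hs.integral_response hv hφ i).trans (hderiv i)
    exact ⟨hs, hmean, hs.coverage hv hφ hJ hα.1.le hmean hmono,
      EDF.ae_bands_eq_explicit_poisson hs hv hφ hJ hα hderiv⟩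
  · have hs := EDF.isAdditiveSample_negBinomial hv hφ hμ hN hlaw hθ
    have hderiv : ∀ i, deriv EDF.cumulantNegBin (θ i) = μ i := fun i => by
      rw [hθ, EDF.deriv_cumulantNegBin_log (hμ i)]
    have hmean := fun i => (hs.integral_response hv hφ i).trans (hderiv i)
    exact ⟨hs, hmean, hs.coverage hv hφ hJ hα.1.le hmean hmono,
      EDF.ae_bands_eq_explicit_negBinomial hs hv hφ hJ hα hderiv⟩
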